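/- **Model (Swap-and-Purify quantum switch).** A switch serves $K$ users; $E=\{(i,j):1\le i<j\le K\}$ is the set of user pairs. Time is slotted. In slot $n$, with queue vector $\mathbf Q(n)\in\mathbb N^{E}$ of pending requests, the following happens. (i) Link-level entanglements are generated: $T_1(n),\dots,T_K(n)$ are independent, $T_i(n)\sim\mathrm{Bin}(\alpha_{\max},p_i)$, so that $\mathbf T(n)\in\mathcal A=\{0,\dots,\alpha_{\max}\}^K$ has law $P_{\mathbf T}(\mathbf a)=\prod_i\binom{\alpha_{\max}}{a_i}p_i^{a_i}(1-p_i)^{\alpha_{\max}-a_i}$; they are lost at the end of the slot. (ii) A (stationary, possibly randomized) scheduling policy chooses from $(\mathbf Q(n),\mathbf T(n))$ a vector $\mathbf W(n)\in\mathbb N^{E}$ that is feasible for $\mathbf T(n)$, where $\boldsymbol\pi\in\mathbb N^E$ is feasible for $\mathbf a$ if, for every user $j$, the sum of $\pi_e$ over the pairs $e$ containing $j$ is at most $a_j$. (iii) For each pair, $\min\{W_{ij}(n),Q_{ij}(n)\}$ swaps are performed, independently successful with probability $q_{ij}$; let $B_{ij}(n)$ be the number of successes. (iv) The $B_{ij}(n)$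 swapped pairs are purified, which delivers a random number $D_{ij}(n)$ of high-fidelity pairs with law $P_{Y|X}(\cdot\mid B_{ij}(n))$, independently over the pairs; here $P_{Y|X}$ is the conditional yield distribution of the purification protocol ($Y$ outputs from $X$ inputs, $Y\le X$). (v) $A_{ij}(n)$ new requests arrive, and $Q_{ij}(n+1)=Q_{ij}(n)-D_{ij}(n)+A_{ij}(n)$. The variables $A_{ij}(n)$ are independent over pairs and slots and independent of everything else; for a rate vector $\boldsymbol\lambda\in[0,\infty)^E$ the law of $A_{ij}(n)$ has mean $\lambda_{ij}$ and finite second moment and, if $\lambda_{ij}>0$, is not carried by a single residue class modulo any integer $d\ge2$; apart from this the laws are arbitrary. The switch is *stable* at $\boldsymbol\lambda$ under a policy if $\mathbf Q(n)$ converges in distribution to a limit $\mathbf Q$ that is the same for all initial queue vectors (with $Q_{ij}(0)=0$ for those pairs that have $\lambda_{ij}=0$), and $\mathbb E[Q_{ij}]<\infty$ for all pairs. The *capacity region* $\Lambda^{SP}$ is the set of $\boldsymbol\lambda\in[0,\infty)^E$ for which the switch is stable under some policy. **Theorem.** For all $p_i,q_{ij}\in[0,1]$, $\alpha_{\max}\in\mathbb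 N$, and every yield distribution $P_{Y|X}$, $$\Lambda^{SP}=\Big\{\boldsymbol\lambda\in[0,\infty)^E:\ \exists\, b_{\mathbf a,\boldsymbol\pi}\ \text{s.t.}\ \boldsymbol\lambda\preceq\sum_{\mathbf a\in\mathcal A,\ \mathbf a\ne 0}P_{\mathbf T}(\mathbf a)\sum_{\boldsymbol\pi\text{ feasible for }\mathbf a}b_{\mathbf a,\boldsymbol\pi}\,\hat H(\boldsymbol\pi),\quad b_{\mathbf a,\boldsymbol\pi}>0,\ \ \sum_{\boldsymbol\pi}b_{\mathbf a,\boldsymbol\pi}<1\ \ \forall \mathbf a\in\mathcal A\Big\},$$ where $\preceq$ is componentwise and $\hat H(\boldsymbol\pi)$ has the components $$\hat H(\pi_{ij})=\sum_{l=0}^{\pi_{ij}}\mathbb E[Y\mid X=l]\binom{\pi_{ij}}{l}q_{ij}^{\,l}(1-q_{ij})^{\pi_{ij}-l}.$$ -/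

import Mathlib

open scoped NNReal ENNReal unitInterval

noncomputable section

namespace QuantumSwitch

/-- The user pairs `(i, j)` with `i < j`. -/
abbrev UserPair (K : ℕ) : Type := {e : Fin K × Fin K // e.1 < e.2}

/-- A vector of natural numbers indexed by the user pairs: a queue vector, a vector of scheduled
swaps, of successful swaps, of deliveries or of new requests. -/
abbrev PairVec (K : ℕ) : Type := UserPair K → ℕ

/-- The parameters of the switch with `K` users. `yieldLaw x` is the conditional law `P_{Y|X}(· | x)`
of the number `Y` of output pairs of the purification routine when it consumes `X = x` pairs; the
routine never outputs more pairs than it consumes. The link fidelity and the fidelity threshold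
influence the model only through `yieldLaw`. -/
structure Params (K : ℕ) where
  /-- number of generation attempts per link and slot -/
  alphaMax : ℕ
  /-- success probability of one generation attempt on link `i` -/
  p : Fin K → I
  /-- success probability of a swap for the pair `e` -/
  q : UserPair K → I
  /-- conditional yield distribution of the purification routine -/
  yieldLaw : ℕ → PMF ℕ
  yieldLaw_le : ∀ x y, yieldLaw x y ≠ 0 → y ≤ x

/-- The law of a vector with independent components, the component `i` having law `μ i`. -/
def indepVec {ι : Type} [Fintype ι] (μ : ι → PMF ℕ) : PMF (ι → ℕ) :=
  (MeasureTheory.Measure.pi fun i => (μ i).toMeasure).toPMF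

/-- The binomial distribution with parameters `n` and `r`. -/
def binomialPMF (n : ℕ) (r : I) : PMF ℕ := (ProbabilityTheory.binomial n r).toPMF

/-- `π` can be scheduled when `a j` link level entanglements are available on link `j`: each swap
for the pair `(i, j)` uses one entanglement of link `i` and one of link `j`. -/
def IsFeasible {K : ℕ} (a : Fin K → ℕ) (π : PairVec K) : Prop :=
  ∀ j : Fin K, (∑ e : UserPair K with e.1.1 = j ∨ e.1.2 = j, π e) ≤ a j

/-- A (stationary, possibly randomized) scheduling policy: given the queue vector and the available
link level entanglements, it selects a feasible number of swaps for each pair. -/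
structure Policy (K : ℕ) where
  select : PairVec K → (Fin K → ℕ) → PMF (PairVec K)
  feasible : ∀ Q a, ∀ W ∈ (select Q a).support, IsFeasible a W

/-- One time slot of the Swap-and-Purify switch started with the queue vector `Q`:
the link level entanglements `T` are generated, the policy selects `W`, `min (W e) (Q e)` swaps are
performed for the pair `e`, of which `B e` succeed, purification turns these into `D e` delivered
pairs, and `A e` new requests arrive; the new queue vector is `Q - D + A`
(here `D e ≤ B e ≤ min (W e) (Q e) ≤ Q e`). -/
def slot {K : ℕ} (sw : Params K) (pol : Policy K) (arr : UserPair K → PMF ℕ) (Q : PairVec K) :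
    PMF (PairVec K) :=
  (indepVec fun i => binomialPMF sw.alphaMax (sw.p i)).bind fun T =>
  (pol.select Q T).bind fun W =>
  (indepVec fun e => binomialPMF (min (W e) (Q e)) (sw.q e)).bind fun B =>
  (indepVec fun e => sw.yieldLaw (B e)).bind fun D =>
  (indepVec arr).bind fun A =>
  PMF.pure fun e => Q e - D e + A e

/-- The law of the queue vector `Q(n)` of the Markov chain with `Q(0) = x`. -/
def queueLaw {K : ℕ} (sw : Params K) (pol : Policy K) (arr : UserPair K → PMF ℕ)
    (x : PairVec K) : ℕ → PMF (PairVec K)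
  | 0 => PMF.pure x
  | n + 1 => (queueLaw sw pol arr x n).bind (slot sw pol arr)

/-- A probability mass function seen as a point of the space of probability measures with the
topology of weak convergence (convergence in distribution). -/
def asProbabilityMeasure {K : ℕ} (μ : PMF (PairVec K)) :
    MeasureTheory.ProbabilityMeasure (PairVec K) :=
  ⟨μ.toMeasure, inferInstance⟩

/-- Stability under a policy: `Q(n)` converges in distribution to a limit that does not depend on
the initial queue vector and that has finite mean. A pair that never issues a request has no
backlog initially. -/
def IsStable {K : ℕ} (sw : Params K) (pol : Policy K) (rate : UserPair K → ℝ≥0)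
    (arr : UserPair K → PMF ℕ) : Prop :=
  ∃ μ : PMF (PairVec K),
    (∀ x : PairVec K, (∀ e, rate e = 0 → x e = 0) →
      Filter.Tendsto (fun n => asProbabilityMeasure (queueLaw sw pol arr x n)) Filter.atTop
        (nhds (asProbabilityMeasure μ))) ∧
    ∀ e, ∑' x : PairVec K, μ x * (x e : ℝ≥0∞) ≠ ⊤

/-- `ν` is an admissible law of the number of requests per slot of a pair with request rate `r`:
it has mean `r` and a finite second moment, and, unless `r = 0`, it is not carried by a single
residue class modulo some `d ≥ 2` (so that the queue is neither deterministic nor confined to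
periodic or separate classes). -/
structure IsRequestLaw (r : ℝ≥0) (ν : PMF ℕ) : Prop where
  mean_eq : ∑' k : ℕ, ν k * (k : ℝ≥0∞) = r
  second_moment : ∑' k : ℕ, ν k * (k : ℝ≥0∞) ^ 2 ≠ ⊤
  span_one : r ≠ 0 → ∀ d : ℕ, 2 ≤ d → ∃ k l : ℕ, ν k ≠ 0 ∧ ν l ≠ 0 ∧ ¬ k ≡ l [MOD d]

/-- The capacity region of the switch: the request rate vectors for which some scheduling policy
makes the switch stable. The requests issued at the rate vector `rate` have the laws `arr rate`. -/
def capacityRegion {K : ℕ} (sw : Params K) (arr : (UserPair K → ℝ≥0) → UserPair K → PMF ℕ) :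
    Set (UserPair K → ℝ≥0) :=
  {rate | ∃ pol : Policy K, IsStable sw pol rate (arr rate)}

/-- The conditional expected yield `E[Y | X = x]`. -/
def expectedYield {K : ℕ} (sw : Params K) (x : ℕ) : ℝ :=
  ∑' y : ℕ, (y : ℝ) * (sw.yieldLaw x y).toReal

/-- The expected purified yield `Ĥ` when `m` swaps are attempted for the pair `e`. -/
def hHat {K : ℕ} (sw : Params K) (e : UserPair K) (m : ℕ) : ℝ :=
  ∑ l ∈ Finset.range (m + 1),
    expectedYield sw l * (m.choose l : ℝ) * (sw.q e : ℝ) ^ l * (1 - (sw.q e : ℝ)) ^ (m - l)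

/-- The probability `P_T(a)` that `a` is the vector of available link level entanglements. -/
def linkProb {K : ℕ} (sw : Params K) (a : Fin K → ℕ) : ℝ :=
  ∏ i, (sw.alphaMax.choose (a i) : ℝ) * (sw.p i : ℝ) ^ a i *
    (1 - (sw.p i : ℝ)) ^ (sw.alphaMax - a i)

/-- The set `{0, …, alphaMax} ^ K` of the possible vectors of available entanglements. -/
def availabilities {K : ℕ} (sw : Params K) : Finset (Fin K → ℕ) :=
  Fintype.piFinset fun _ => Finset.range (sw.alphaMax + 1)

open Classical in
/-- The vectors of swaps that are feasible for `a` (for `a` in `availabilities sw`, all of them). -/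
def allocations {K : ℕ} (sw : Params K) (a : Fin K → ℕ) : Finset (PairVec K) :=
  {π ∈ Fintype.piFinset fun _ => Finset.range (sw.alphaMax + 1) | IsFeasible a π}

theorem mem_allocations {K : ℕ} (sw : Params K) {a : Fin K → ℕ} (ha : a ∈ availabilities sw)
    (π : PairVec K) : π ∈ allocations sw a ↔ IsFeasible a π := by
  classical
  simp only [allocations, Finset.mem_filter, Fintype.mem_piFinset, Finset.mem_range,
    and_iff_right_iff_imp]
  intro h e
  have h1 : π e ≤ ∑ f : UserPair K with f.1.1 = e.1.1 ∨ f.1.2 = e.1.1, π f :=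
    Finset.single_le_sum (f := π) (fun _ _ => Nat.zero_le _) (by simp)
  have h2 := h e.1.1
  have h3 := Fintype.mem_piFinset.1 ha e.1.1
  rw [Finset.mem_range] at h3
  omega

/-- The explicit region: the rate vectors dominated by
`∑_{a ≠ 0} P_T(a) ∑_π b a π • Ĥ(π)` for some weights `b a π > 0` with `∑_π b a π < 1`. -/
def explicitRegion {K : ℕ} (sw : Params K) : Set (UserPair K → ℝ≥0) :=
  {rate | ∃ b : (Fin K → ℕ) → PairVec K → ℝ,
    (∀ e, (rate e : ℝ) ≤ ∑ a ∈ availabilities sw with a ≠ 0,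
      linkProb sw a * ∑ π ∈ allocations sw a, b a π * hHat sw e (π e)) ∧
    (∀ a ∈ availabilities sw, ∀ π ∈ allocations sw a, 0 < b a π) ∧
    ∀ a ∈ availabilities sw, ∑ π ∈ allocations sw a, b a π < 1}

end QuantumSwitch

end

/-! Necessity. If `rate` lies outside the region, Hahn–Banach gives nonnegative weights `w`, nonzero
at some pair with positive rate, for which no choice of swaps has a weighted service rate above `∑ w
e * rate e` (`exists_supporting_weights`). Under a stable policy the limit law is invariant, and the
weighted backlog has nonnegative drift in every state and finite stationary mean. So the drift
vanishes on the support of the limit. Since `ℕ^E` is well-quasi-ordered, the weighted backlog has a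
minimum over that support. A slot started at a minimizer never goes below the minimum and keeps the
mean, so the backlog is unchanged almost surely. This is absurd, because the arrivals of a pair with
positive weight and positive rate are random (`mem_explicitRegion_of_isStable`). This argument also
excludes the critical boundary.

Sufficiency. The total weight below one leaves room to scale all weights up by a factor `1 + η` and
to spend the remaining mass on idling. The resulting policy ignores the queues and serves every pair
of positive rate strictly faster than requests arrive (`exists_swap_laws`), so the sum of squared
queue lengths is a Lyapunov function. Idling lets two independent copies of the chain differ by
arrivals alone, and the residue condition on the arrivals then lets them meet (`meet_of_idle`).

Convergence follows from an ergodic theorem proved without recurrence or return times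
(`IsErgodic.exists_limit`). For a bounded test function, the limsup of the truncated difference of
expectations from two starting points is subharmonic for two independent copies. The Lyapunov
function makes it attain its maximum; the maximum spreads along possible transitions to the
diagonal, where the difference is zero. Thus the initial law is forgotten, while the drift bound
gives tightness along suitable times and hence a limit law. -/

noncomputable section

namespace QuantumSwitch

open Filter Topology

/-! ### Expectations under discrete laws and their limits -/

section Mean

variable {α β : Type*}

/-- The expectation of a nonnegative function under a probability mass function. -/
def mean (p : PMF α) (f : α → ℝ≥0∞) : ℝ≥0∞ := ∑' x, p x * f x

theorem mean_pure (a : α) (f : α → ℝ≥0∞) : mean (PMF.pure a) f = f a := by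
  unfold mean
  rw [tsum_eq_single a]
  · simp
  · intro b hb
    simp [PMF.pure_apply_of_ne _ _ hb]

theorem mean_bind (p : PMF α) (g : α → PMF β) (f : β → ℝ≥0∞) :
    mean (p.bind g) f = mean p fun a => mean (g a) f := by
  unfold mean
  simp only [PMF.bind_apply, ← ENNReal.tsum_mul_right, ← ENNReal.tsum_mul_left, mul_assoc]
  exact ENNReal.tsum_comm

theorem mean_map (p : PMF α) (g : α → β) (f : β → ℝ≥0∞) :
    mean (p.map g) f = mean p fun a => f (g a) := by
  rw [PMF.map, mean_bind]
  simp [mean_pure]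

theorem mean_const (p : PMF α) (c : ℝ≥0∞) : mean p (fun _ => c) = c := by
  simp [mean, ENNReal.tsum_mul_right]

theorem mean_add (p : PMF α) (f g : α → ℝ≥0∞) :
    mean p (fun x => f x + g x) = mean p f + mean p g := by
  simp only [mean, mul_add]
  exact ENNReal.tsum_add

theorem mean_sum {ι : Type*} (p : PMF α) (s : Finset ι) (f : ι → α → ℝ≥0∞) :
    mean p (fun x => ∑ i ∈ s, f i x) = ∑ i ∈ s, mean p (f i) := by
  classical
  induction s using Finset.induction_on with
  | empty => simp [mean_const]
  | insert i s hi ih => simp only [Finset.sum_insert hi, mean_add, ih]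

theorem mean_const_mul (p : PMF α) (c : ℝ≥0∞) (f : α → ℝ≥0∞) :
    mean p (fun x => c * f x) = c * mean p f := by
  simp only [mean, ← ENNReal.tsum_mul_left]
  exact tsum_congr fun x => by ring

theorem mean_mono {p : PMF α} {f g : α → ℝ≥0∞} (h : ∀ x, p x ≠ 0 → f x ≤ g x) :
    mean p f ≤ mean p g := by
  refine ENNReal.tsum_le_tsum fun x => ?_
  by_cases hx : p x = 0
  · simp [hx]
  · gcongr
    exact h x hx

theorem mean_congr {p : PMF α} {f g : α → ℝ≥0∞} (h : ∀ x, p x ≠ 0 → f x = g x) :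
    mean p f = mean p g :=
  le_antisymm (mean_mono fun x hx => (h x hx).le) (mean_mono fun x hx => (h x hx).ge)

theorem mean_indicator (p : PMF α) [DecidableEq α] (a : α) :
    mean p (fun x => if x = a then 1 else 0) = p a := by
  unfold mean
  rw [tsum_eq_single a]
  · simp
  · intro b hb
    simp [hb]

/-- If `f` dominates `g` on the support and has the same finite mean, they agree there. -/
theorem eq_of_mean_le {p : PMF α} {f g : α → ℝ≥0∞} (hgf : ∀ x, p x ≠ 0 → g x ≤ f x)
    (hfin : mean p g ≠ ⊤) (hle : mean p f ≤ mean p g) (x : α) (hx : p x ≠ 0) : f x = g x := by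
  have hsplit : mean p f = mean p g + mean p (fun x => f x - g x) := by
    rw [← mean_add]
    exact mean_congr fun x hx => (add_tsub_cancel_of_le (hgf x hx)).symm
  have h0 : mean p (fun x => f x - g x) = 0 := by
    rw [hsplit] at hle
    by_contra hne
    exact absurd hle (not_le.2 (ENNReal.lt_add_right hfin hne))
  have hz := ENNReal.tsum_eq_zero.1 h0 x
  rcases mul_eq_zero.1 hz with h | h
  · exact absurd h hx
  · exact le_antisymm (tsub_eq_zero_iff_le.1 h) (hgf x hx)

theorem mean_eq_lintegral [MeasurableSpace α] [MeasurableSingletonClass α] [Countable α]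
    (p : PMF α) (f : α → ℝ≥0∞) : mean p f = ∫⁻ x, f x ∂p.toMeasure := by
  rw [MeasureTheory.lintegral_countable']
  refine tsum_congr fun x => ?_
  rw [PMF.toMeasure_apply_singleton _ _ (measurableSet_singleton x), mul_comm]

/-- Reverse Fatou, with the constant 1 as dominating function. -/
theorem limsup_mean_le [Countable α] (p : PMF α) (u : ℕ → α → ℝ≥0∞) (hu : ∀ n x, u n x ≤ 1) :
    limsup (fun n => mean p (u n)) atTop ≤ mean p fun x => limsup (fun n => u n x) atTop := by
  let _ : MeasurableSpace α := ⊤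
  simp only [mean_eq_lintegral]
  refine MeasureTheory.limsup_lintegral_le (fun _ => 1) (fun n => measurable_from_top)
    (fun n => Eventually.of_forall (hu n)) ?_
  simp

/-- The product of two probability mass functions. -/
def prodLaw (p : PMF α) (q : PMF β) : PMF (α × β) := p.bind fun x => q.map (Prod.mk x)

theorem mean_prodLaw (p : PMF α) (q : PMF β) (f : α × β → ℝ≥0∞) :
    mean (prodLaw p q) f = mean p fun x => mean q fun y => f (x, y) := by
  simp only [prodLaw, mean_bind, mean_map]

theorem prodLaw_ne_zero (p : PMF α) (q : PMF β) (z : α × β) :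
    prodLaw p q z ≠ 0 ↔ p z.1 ≠ 0 ∧ q z.2 ≠ 0 := by
  rw [← PMF.mem_support_iff]
  obtain ⟨a, b⟩ := z
  simp [prodLaw, and_comm]

theorem pmf_eq_of_le {p q : PMF α} (h : ∀ x, p x ≤ q x) : p = q := by
  ext x
  have := eq_of_mean_le (p := PMF.pure x) (f := q) (g := p) (fun y _ => h y)
    (by rw [mean_pure]; exact p.apply_ne_top x) ?_ x (by simp)
  · exact this.symm
  · rw [mean_pure, mean_pure]
    by_contra hlt
    have := ENNReal.tsum_lt_tsum (f := p) (g := q) p.tsum_coe_ne_top h (not_le.1 hlt)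
    simp at this

theorem mean_le_of_tendsto {ι : Type*} {L : Filter ι} [NeBot L] {ν : ι → PMF α} {μ : PMF α}
    (hν : ∀ x, Tendsto (fun i => ν i x) L (𝓝 (μ x))) {f : α → ℝ≥0∞} (hf : ∀ x, f x ≠ ⊤)
    {c : ℝ≥0∞} (hc : ∃ᶠ i in L, mean (ν i) f ≤ c) : mean μ f ≤ c := by
  unfold mean
  rw [ENNReal.tsum_eq_iSup_sum]
  refine iSup_le fun F => ?_
  have ht : Tendsto (fun i => ∑ x ∈ F, ν i x * f x) L (𝓝 (∑ x ∈ F, μ x * f x)) :=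
    tendsto_finsetSum _ fun x _ => ENNReal.Tendsto.mul_const (hν x) (Or.inr (hf x))
  refine le_of_tendsto_of_frequently ht (hc.mono fun i hi => ?_)
  exact (ENNReal.sum_le_tsum F).trans hi

/-- Finite partial sums pass to the limit, so `μ.bind P ≤ μ` pointwise; both sides have mass one,
which forces equality. No tightness is needed because `μ` is already known to be a probability law.
-/
theorem bind_eq_of_tendsto {ι : Type*} {L : Filter ι} [NeBot L] {P : α → PMF α} {ν : ι → PMF α}
    {μ : PMF α} (hν : ∀ x, Tendsto (fun i => ν i x) L (𝓝 (μ x)))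
    (hν' : ∀ x, Tendsto (fun i => (ν i).bind P x) L (𝓝 (μ x))) : μ.bind P = μ := by
  refine pmf_eq_of_le fun z => ?_
  rw [PMF.bind_apply, ENNReal.tsum_eq_iSup_sum]
  refine iSup_le fun F => ?_
  have ht : Tendsto (fun i => ∑ x ∈ F, ν i x * P x z) L (𝓝 (∑ x ∈ F, μ x * P x z)) :=
    tendsto_finsetSum _ fun x _ =>
      ENNReal.Tendsto.mul_const (hν x) (Or.inr ((P x).apply_ne_top z))
  refine le_of_tendsto_of_tendsto' ht (hν' z) fun i => ?_
  rw [PMF.bind_apply]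
  exact ENNReal.sum_le_tsum F

end Mean

/-! ### An ergodic theorem from a Lyapunov function and meeting copies -/

section MarkovChain

variable {S : Type*}

/-- The law after `n` steps of the Markov chain with transition kernel `P` started at `x`. -/
def iterLaw (P : S → PMF S) (x : S) : ℕ → PMF S
  | 0 => PMF.pure x
  | n + 1 => (iterLaw P x n).bind P

theorem iterLaw_succ' (P : S → PMF S) (x : S) (n : ℕ) :
    iterLaw P x (n + 1) = (P x).bind fun y => iterLaw P y n := by
  induction n with
  | zero => simp [iterLaw, PMF.pure_bind]
  | succ n ih => rw [iterLaw, ih, PMF.bind_bind]; rfl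

theorem bind_iterLaw {P : S → PMF S} {μ : PMF S} (h : μ.bind P = μ) (n : ℕ) :
    μ.bind (fun y => iterLaw P y n) = μ := by
  induction n with
  | zero => simp [iterLaw]
  | succ n ih =>
    simp only [iterLaw]
    rw [← PMF.bind_bind, ih, h]

/-- A bounded subharmonic function of a Markov chain with a Lyapunov function attains its
maximum. -/
theorem exists_max_of_subharmonic (R : S → PMF S) (s : Set S)
    (hs : ∀ z ∈ s, ∀ z', R z z' ≠ 0 → z' ∈ s) (V : S → ℝ≥0)
    (hV : ∀ c, {z ∈ s | V z ≤ c}.Finite) (C : Set S) (hC : (C ∩ s).Finite)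
    (hdrift : ∀ z ∈ s, z ∉ C → mean (R z) (fun z' => (V z' : ℝ≥0∞)) + 1 ≤ V z)
    (g : S → ℝ≥0∞) (hg : ∀ z, g z ≤ 1) (hsub : ∀ z ∈ s, g z ≤ mean (R z) g)
    (hne : s.Nonempty) : ∃ z₀ ∈ s, ∀ z ∈ s, g z ≤ g z₀ := by
  have gfin : ∀ z, g z ≠ ⊤ := fun z => ne_top_of_le_ne_top ENNReal.one_ne_top (hg z)
  have key : ∀ M : ℝ≥0∞, (∀ z ∈ C ∩ s, g z ≤ M) → ∀ z ∈ s, g z ≤ M := by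
    intro M hM z₁ hz₁
    by_contra hlt
    rw [not_le] at hlt
    have hMfin : M ≠ ⊤ := hlt.ne_top
    have hltR : M.toReal < (g z₁).toReal := (ENNReal.toReal_lt_toReal hMfin (gfin z₁)).2 hlt
    -- A penalty `η * V` small enough that `g - η * V` still exceeds `M` at `z₁`. It forces a
    -- maximum to exist.
    obtain ⟨η, hη, hηlt⟩ : ∃ η : ℝ, 0 < η ∧ M.toReal < (g z₁).toReal - η * V z₁ := by
      refine ⟨((g z₁).toReal - M.toReal) / (2 * (V z₁ + 1)), ?_, ?_⟩
      · have : (0 : ℝ) ≤ V z₁ := (V z₁).2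
        apply div_pos <;> linarith
      · have hv : (0 : ℝ) ≤ V z₁ := (V z₁).2
        have : ((g z₁).toReal - M.toReal) / (2 * (V z₁ + 1)) * V z₁
            ≤ ((g z₁).toReal - M.toReal) / 2 := by
          rw [div_mul_eq_mul_div, div_le_div_iff₀ (by linarith) (by norm_num)]
          nlinarith
        linarith
    set φ : S → ℝ := fun z => (g z).toReal - η * V z with hφ
    have hF := hV (1 / η.toNNReal + V z₁)
    obtain ⟨z₀, hz₀F, hz₀⟩ := hF.toFinset.exists_max_image φ
      ⟨z₁, by simp [hz₁]⟩
    have hz₀s : z₀ ∈ s := by simp at hz₀F; exact hz₀F.1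
    have h1 : φ z₁ ≤ φ z₀ := hz₀ z₁ (by simp [hz₁])
    have hmax : ∀ z ∈ s, φ z ≤ φ z₀ := by
      intro z hz
      -- Outside this finite set the penalty exceeds `1 + η * V z₁`, while `g ≤ 1`; so the maximum
      -- over the set is global.
      by_cases hzF : V z ≤ 1 / η.toNNReal + V z₁
      · exact hz₀ z (by simpa using ⟨hz, by simpa using hzF⟩)
      · rw [not_le] at hzF
        refine le_trans ?_ h1
        have h2 : (1 / η + V z₁ : ℝ) < V z := by
          have := NNReal.coe_lt_coe.2 hzF
          push_cast at this
          rwa [Real.coe_toNNReal _ hη.le] at this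
        have h3 : (g z).toReal ≤ 1 := by
          have := ENNReal.toReal_mono ENNReal.one_ne_top (hg z)
          simpa using this
        have h4 : (0 : ℝ) ≤ (g z₁).toReal := ENNReal.toReal_nonneg
        have h5 : η * (1 / η + V z₁) < η * V z := by gcongr
        rw [mul_add, mul_one_div_cancel hη.ne'] at h5
        simp only [hφ]
        linarith
    have hpos : M.toReal < φ z₀ := lt_of_lt_of_le hηlt h1
    have hm0 : 0 ≤ φ z₀ := le_trans ENNReal.toReal_nonneg hpos.le
    have hz₀C : z₀ ∉ C := by
      intro hc
      have := ENNReal.toReal_mono hMfin (hM z₀ ⟨hc, hz₀s⟩)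
      have h6 : (0 : ℝ) ≤ η * V z₀ := by positivity
      simp only [hφ] at hpos
      linarith
    have hbound : ∀ z ∈ s, g z ≤ ENNReal.ofReal η * V z + ENNReal.ofReal (φ z₀) := by
      intro z hz
      rw [← ENNReal.ofReal_toReal (gfin z), ← ENNReal.ofReal_coe_nnreal,
        ← ENNReal.ofReal_mul hη.le, ← ENNReal.ofReal_add (by positivity) hm0]
      apply ENNReal.ofReal_le_ofReal
      have := hmax z hz
      simp only [hφ] at this ⊢
      linarith
    -- At the maximizer, subharmonicity and the drift of at most `-1` would push `g z₀` up by `η`.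
    have hsum : g z₀ + ENNReal.ofReal η ≤ g z₀ := by
      calc g z₀ + ENNReal.ofReal η
          ≤ mean (R z₀) (fun z => ENNReal.ofReal η * V z + ENNReal.ofReal (φ z₀))
              + ENNReal.ofReal η := by
            gcongr
            exact (hsub z₀ hz₀s).trans (mean_mono fun z hz => hbound z (hs z₀ hz₀s z hz))
        _ = ENNReal.ofReal η * (mean (R z₀) (fun z => (V z : ℝ≥0∞)) + 1)
              + ENNReal.ofReal (φ z₀) := by
            rw [mean_add, mean_const, mean_const_mul]
            ring
        _ ≤ ENNReal.ofReal η * V z₀ + ENNReal.ofReal (φ z₀) := by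
            gcongr
            exact hdrift z₀ hz₀s hz₀C
        _ = g z₀ := by
            rw [← ENNReal.ofReal_coe_nnreal, ← ENNReal.ofReal_mul hη.le,
              ← ENNReal.ofReal_add (by positivity) hm0]
            rw [← ENNReal.ofReal_toReal (gfin z₀)]
            congr 1
            simp [hφ]
    exact absurd hsum (not_le.2 (ENNReal.lt_add_right (gfin z₀) (by simpa using hη)))
  by_cases hemp : (C ∩ s).Nonempty
  · obtain ⟨z₀, hz₀, hmax⟩ := hC.toFinset.exists_max_image g (by simpa using hemp)
    refine ⟨z₀, ?_, key _ fun z hz => hmax z (by simpa using hz)⟩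
    simp at hz₀
    exact hz₀.2
  · obtain ⟨z₀, hz₀⟩ := hne
    refine ⟨z₀, hz₀, key _ fun z hz => absurd ⟨z, hz⟩ hemp⟩

/-- The (truncated) difference of the expectations of `h` after `n` steps from `x` and `y`. -/
def gap (P : S → PMF S) (h : S → ℝ≥0∞) (n : ℕ) (z : S × S) : ℝ≥0∞ :=
  mean (iterLaw P z.1 n) h - mean (iterLaw P z.2 n) h

theorem mean_le_one {p : PMF S} {h : S → ℝ≥0∞} (hh : ∀ x, h x ≤ 1) : mean p h ≤ 1 :=
  (mean_mono fun x _ => hh x).trans (mean_const p 1).le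

theorem gap_le_one {P : S → PMF S} {h : S → ℝ≥0∞} (hh : ∀ x, h x ≤ 1) (n : ℕ) (z : S × S) :
    gap P h n z ≤ 1 :=
  tsub_le_self.trans (mean_le_one hh)

/-- Integrate `f x ≤ (f x - f y) + f y` over the independent coupling; the subtraction is truncated.
-/
theorem mean_tsub_mean_le (p q : PMF S) (f : S → ℝ≥0∞) :
    mean p f - mean q f ≤ mean (prodLaw p q) fun z => f z.1 - f z.2 := by
  rw [tsub_le_iff_right]
  calc mean p f = mean (prodLaw p q) fun z => f z.1 := by simp [mean_prodLaw, mean_const]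
    _ ≤ mean (prodLaw p q) fun z => (f z.1 - f z.2) + f z.2 :=
        mean_mono fun z _ => le_tsub_add
    _ = _ := by
        rw [mean_add]
        congr 1
        simp [mean_prodLaw, mean_const]

theorem mean_bind_iterLaw_tsub_le (P : S → PMF S) (h : S → ℝ≥0∞) (p q : PMF S) (n : ℕ) :
    mean (p.bind fun y => iterLaw P y n) h - mean (q.bind fun y => iterLaw P y n) h
      ≤ mean (prodLaw p q) (gap P h n) := by
  rw [mean_bind, mean_bind]
  exact mean_tsub_mean_le p q fun y => mean (iterLaw P y n) h

theorem gap_succ_le (P : S → PMF S) (h : S → ℝ≥0∞) (n : ℕ) (z : S × S) :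
    gap P h (n + 1) z ≤ mean (prodLaw (P z.1) (P z.2)) (gap P h n) := by
  rw [gap, iterLaw_succ', iterLaw_succ']
  exact mean_bind_iterLaw_tsub_le P h _ _ n

/-- The conditions under which the ergodic theorem below is proved: `s` is closed under the
transitions, `V` is a Lyapunov function whose drift is at most `b - f`, where `f` has finite
sublevel sets, and two copies of the chain can meet. -/
structure IsErgodic (P : S → PMF S) (s : Set S) (V f : S → ℝ≥0) (b : ℝ≥0) : Prop where
  closed : ∀ x ∈ s, ∀ y, P x y ≠ 0 → y ∈ s
  drift : ∀ x ∈ s, mean (P x) (fun y => (V y : ℝ≥0∞)) + f x ≤ V x + b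
  finite : ∀ c, {x ∈ s | f x ≤ c}.Finite
  meet : ∀ x ∈ s, ∀ y ∈ s, ∃ z, Relation.ReflTransGen
    (fun v w : S × S => P v.1 w.1 ≠ 0 ∧ P v.2 w.2 ≠ 0) (x, y) (z, z)

namespace IsErgodic

variable {P : S → PMF S} {s : Set S} {V f : S → ℝ≥0} {b : ℝ≥0}

theorem le_lyapunov (H : IsErgodic P s V f b) {x : S} (hx : x ∈ s) : f x ≤ V x + b := by
  have := (le_add_self).trans (H.drift x hx)
  exact_mod_cast this

theorem closed_iterLaw (H : IsErgodic P s V f b) {x : S} (hx : x ∈ s) (n : ℕ) {y : S}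
    (hy : iterLaw P x n y ≠ 0) : y ∈ s := by
  induction n generalizing y with
  | zero =>
    rw [← PMF.mem_support_iff, iterLaw, PMF.mem_support_pure_iff] at hy
    rwa [hy]
  | succ n ih =>
    rw [← PMF.mem_support_iff, iterLaw, PMF.mem_support_bind_iff] at hy
    obtain ⟨w, hw, hwy⟩ := hy
    exact H.closed w (ih hw) y hwy

/-- The limsup is subharmonic for two independent copies and vanishes on the diagonal, which can be
reached from a maximizer. -/
theorem limsup_gap_eq_zero [Countable S] (H : IsErgodic P s V f b) {h : S → ℝ≥0∞}
    (hh : ∀ x, h x ≤ 1) {z : S × S} (hz : z ∈ s ×ˢ s) :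
    limsup (fun n => gap P h n z) atTop = 0 := by
  set g : S × S → ℝ≥0∞ := fun z => limsup (fun n => gap P h n z) atTop with hgdef
  have hg1 : ∀ z, g z ≤ 1 := fun z =>
    limsup_le_of_le (by isBoundedDefault) (Eventually.of_forall fun n => gap_le_one hh n z)
  set R : S × S → PMF (S × S) := fun z => prodLaw (P z.1) (P z.2) with hR
  have hclosed : ∀ z ∈ s ×ˢ s, ∀ z', R z z' ≠ 0 → z' ∈ s ×ˢ s := by
    intro z hz z' hz'
    rw [hR, prodLaw_ne_zero] at hz'
    exact ⟨H.closed _ hz.1 _ hz'.1, H.closed _ hz.2 _ hz'.2⟩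
  have hsub : ∀ z ∈ s ×ˢ s, g z ≤ mean (R z) g := by
    intro z _
    calc g z = limsup (fun n => gap P h (n + 1) z) atTop := (limsup_nat_add _ 1).symm
      _ ≤ limsup (fun n => mean (R z) (gap P h n)) atTop :=
          limsup_le_limsup (Eventually.of_forall fun n => gap_succ_le P h n z)
      _ ≤ mean (R z) g := limsup_mean_le _ _ fun n z => gap_le_one hh n z
  have hfin2 : ∀ c, {z ∈ s ×ˢ s | f z.1 + f z.2 ≤ c}.Finite := by
    intro c
    refine ((H.finite c).prod (H.finite c)).subset ?_
    rintro ⟨x, y⟩ ⟨⟨hx, hy⟩, hc⟩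
    exact ⟨⟨hx, le_self_add.trans hc⟩, ⟨hy, le_add_self.trans hc⟩⟩
  -- The drifts of the two copies add up to at most `2 * b - f z.1 - f z.2`, hence the exceptional
  -- set `f z.1 + f z.2 ≤ 2 * b + 1`.
  obtain ⟨z₀, hz₀s, hmax⟩ := exists_max_of_subharmonic R (s ×ˢ s) hclosed
    (fun z => V z.1 + V z.2) (by
      intro c
      refine (hfin2 (c + 2 * b)).subset ?_
      rintro z ⟨hz, hc⟩
      refine ⟨hz, ?_⟩
      calc f z.1 + f z.2 ≤ (V z.1 + b) + (V z.2 + b) :=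
            add_le_add (H.le_lyapunov hz.1) (H.le_lyapunov hz.2)
        _ = (V z.1 + V z.2) + 2 * b := by ring
        _ ≤ c + 2 * b := by gcongr)
    {z | f z.1 + f z.2 ≤ 2 * b + 1} ((hfin2 (2 * b + 1)).subset fun z hz => ⟨hz.2, hz.1⟩)
    (by
      intro z hz hzC
      have hlt : 2 * b + 1 < f z.1 + f z.2 := not_le.1 hzC
      have hE : mean (R z) (fun z' => ((V z'.1 + V z'.2 : ℝ≥0) : ℝ≥0∞))
          = mean (P z.1) (fun y => (V y : ℝ≥0∞)) + mean (P z.2) (fun y => (V y : ℝ≥0∞)) := by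
        simp only [hR, ENNReal.coe_add, mean_prodLaw, mean_add, mean_const]
      have h1 := H.drift z.1 hz.1
      have h2 := H.drift z.2 hz.2
      rw [hE]
      have h3 : (2 * b + 1 : ℝ≥0∞) ≤ f z.1 + f z.2 := by exact_mod_cast hlt.le
      have h4 : (mean (P z.1) (fun y => (V y : ℝ≥0∞)) + mean (P z.2) (fun y => (V y : ℝ≥0∞)) + 1)
          + 2 * b ≤ ((V z.1 + V z.2 : ℝ≥0) : ℝ≥0∞) + 2 * b := by
        calc _ = (mean (P z.1) (fun y => (V y : ℝ≥0∞)) + mean (P z.2) (fun y => (V y : ℝ≥0∞)))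
              + (2 * b + 1) := by ring
          _ ≤ (mean (P z.1) (fun y => (V y : ℝ≥0∞)) + mean (P z.2) (fun y => (V y : ℝ≥0∞)))
              + (f z.1 + f z.2) := by gcongr
          _ = (mean (P z.1) (fun y => (V y : ℝ≥0∞)) + f z.1)
              + (mean (P z.2) (fun y => (V y : ℝ≥0∞)) + f z.2) := by ring
          _ ≤ (V z.1 + b) + (V z.2 + b) := add_le_add h1 h2
          _ = _ := by push_cast; ring
      exact (ENNReal.add_le_add_iff_right
        (ENNReal.mul_ne_top (by simp) ENNReal.coe_ne_top)).1 h4)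
    g hg1 hsub ⟨z, hz⟩
  -- A mean of values at most `g z₀` that is at least `g z₀` has only the value `g z₀` on its
  -- support.
  have hstep : ∀ v w : S × S, v ∈ s ×ˢ s → g v = g z₀ → R v w ≠ 0 → g w = g z₀ := by
    intro v w hv hgv hvw
    refine (eq_of_mean_le (p := R v) (f := fun _ => g z₀) (g := g)
      (fun x hx => hmax x (hclosed v hv x hx)) ?_ ?_ w hvw).symm
    · exact ne_top_of_le_ne_top ENNReal.one_ne_top (mean_le_one hg1)
    · rw [mean_const, ← hgv]
      exact hsub v hv
  obtain ⟨w, hw⟩ := H.meet z₀.1 hz₀s.1 z₀.2 hz₀s.2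
  have hpath : ∀ v, Relation.ReflTransGen (fun v w : S × S => P v.1 w.1 ≠ 0 ∧ P v.2 w.2 ≠ 0) z₀ v →
      v ∈ s ×ˢ s ∧ g v = g z₀ := by
    intro v hv
    induction hv with
    | refl => exact ⟨hz₀s, rfl⟩
    | @tail v₁ v₂ _ hst ih =>
      have hne : R v₁ v₂ ≠ 0 := (prodLaw_ne_zero _ _ _).2 hst
      exact ⟨hclosed _ ih.1 _ hne, hstep _ _ ih.1 ih.2 hne⟩
  have h0 : g (w, w) = 0 := by simp [hgdef, gap]
  have := hmax z hz
  rw [← (hpath _ hw).2, h0] at this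
  exact le_antisymm this bot_le

theorem tendsto_mean_gap [Countable S] (H : IsErgodic P s V f b) {h : S → ℝ≥0∞}
    (hh : ∀ x, h x ≤ 1) {p q : PMF S} (hp : ∀ x, p x ≠ 0 → x ∈ s) (hq : ∀ x, q x ≠ 0 → x ∈ s) :
    Tendsto (fun n => mean (p.bind fun y => iterLaw P y n) h
      - mean (q.bind fun y => iterLaw P y n) h) atTop (𝓝 0) := by
  have hlim : limsup (fun n => mean (prodLaw p q) (gap P h n)) atTop = 0 := by
    refine le_antisymm ?_ bot_le
    refine (limsup_mean_le _ _ fun n z => gap_le_one hh n z).trans ?_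
    rw [← mean_const (prodLaw p q) 0]
    refine mean_mono fun z hz => ?_
    rw [prodLaw_ne_zero] at hz
    exact (H.limsup_gap_eq_zero hh ⟨hp _ hz.1, hq _ hz.2⟩).le
  have ht : Tendsto (fun n => mean (prodLaw p q) (gap P h n)) atTop (𝓝 0) :=
    tendsto_of_le_liminf_of_limsup_le bot_le hlim.le
  exact tendsto_of_tendsto_of_tendsto_of_le_of_le tendsto_const_nhds ht (fun _ => bot_le)
    fun n => mean_bind_iterLaw_tsub_le P h p q n

/-- Two initial laws are asymptotically indistinguishable. -/
theorem tendsto_of_tendsto [Countable S] (H : IsErgodic P s V f b) {h : S → ℝ≥0∞}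
    (hh : ∀ x, h x ≤ 1) {p q : PMF S} (hp : ∀ x, p x ≠ 0 → x ∈ s) (hq : ∀ x, q x ≠ 0 → x ∈ s)
    {L : Filter ℕ} (hL : L ≤ atTop) {c : ℝ≥0∞}
    (hc : Tendsto (fun n => mean (q.bind fun y => iterLaw P y n) h) L (𝓝 c)) :
    Tendsto (fun n => mean (p.bind fun y => iterLaw P y n) h) L (𝓝 c) := by
  have h1 := (H.tendsto_mean_gap hh hp hq).mono_left hL
  have h2 := (H.tendsto_mean_gap hh hq hp).mono_left hL
  have lower := ENNReal.Tendsto.sub hc h2 (Or.inr ENNReal.zero_ne_top)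
  have upper := h1.add hc
  rw [tsub_zero] at lower
  rw [zero_add] at upper
  refine tendsto_of_tendsto_of_tendsto_of_le_of_le lower upper (fun n => ?_) (fun n => ?_)
  · refine tsub_le_iff_left.2 ?_
    exact le_tsub_add
  · exact le_tsub_add

theorem sum_mean_le (H : IsErgodic P s V f b) {x : S} (hx : x ∈ s) (n : ℕ) :
    mean (iterLaw P x n) (fun y => (V y : ℝ≥0∞))
      + ∑ k ∈ Finset.range n, mean (iterLaw P x k) (fun y => (f y : ℝ≥0∞)) ≤ V x + n * b := by
  induction n with
  | zero => simp [iterLaw, mean_pure]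
  | succ n ih =>
    have h1 : mean (iterLaw P x (n + 1)) (fun y => (V y : ℝ≥0∞))
        + mean (iterLaw P x n) (fun y => (f y : ℝ≥0∞))
        ≤ mean (iterLaw P x n) (fun y => (V y : ℝ≥0∞)) + b := by
      rw [iterLaw, mean_bind, ← mean_add, ← mean_const (iterLaw P x n) (b : ℝ≥0∞), ← mean_add]
      refine mean_mono fun y hy => ?_
      exact H.drift y (H.closed_iterLaw hx n hy)
    rw [Finset.sum_range_succ, Nat.cast_succ, add_mul, one_mul]
    calc _ = (mean (iterLaw P x (n + 1)) (fun y => (V y : ℝ≥0∞))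
          + mean (iterLaw P x n) (fun y => (f y : ℝ≥0∞)))
          + ∑ k ∈ Finset.range n, mean (iterLaw P x k) (fun y => (f y : ℝ≥0∞)) := by ring
      _ ≤ (mean (iterLaw P x n) (fun y => (V y : ℝ≥0∞)) + b)
          + ∑ k ∈ Finset.range n, mean (iterLaw P x k) (fun y => (f y : ℝ≥0∞)) := by gcongr
      _ = (mean (iterLaw P x n) (fun y => (V y : ℝ≥0∞))
          + ∑ k ∈ Finset.range n, mean (iterLaw P x k) (fun y => (f y : ℝ≥0∞))) + b := by ring
      _ ≤ _ := by rw [← add_assoc]; gcongr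

/-- Otherwise the summed drift inequality fails: the sum of the means of `f` would eventually grow
by more than `b + 1` per step, against a budget of `b` per step. -/
theorem frequently_mean_le (H : IsErgodic P s V f b) {x : S} (hx : x ∈ s) :
    ∃ᶠ n in atTop, mean (iterLaw P x n) (fun y => (f y : ℝ≥0∞)) ≤ b + 1 := by
  intro hcon
  obtain ⟨N, hN⟩ := eventually_atTop.1 hcon
  obtain ⟨m, hm⟩ := exists_nat_gt (V x + N * b)
  have h1 := H.sum_mean_le hx (N + m)
  have h2 : (m : ℝ≥0∞) * (b + 1) ≤ V x + (N + m : ℕ) * b := by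
    refine le_trans ?_ (le_add_self.trans h1)
    calc (m : ℝ≥0∞) * (b + 1) = ∑ k ∈ Finset.range m, ((b : ℝ≥0∞) + 1) := by
          rw [Finset.sum_const, Finset.card_range, nsmul_eq_mul]
      _ ≤ ∑ k ∈ Finset.range m, mean (iterLaw P x (N + k)) (fun y => (f y : ℝ≥0∞)) :=
          Finset.sum_le_sum fun k _ => (not_le.1 (hN (N + k) (by omega))).le
      _ ≤ _ := by
          rw [Finset.sum_range_add]
          exact le_add_self
  have h3 : (m : ℝ≥0) * (b + 1) ≤ V x + (N + m : ℕ) * b := by exact_mod_cast h2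
  push_cast at h3
  have h4 : (m : ℝ≥0) ≤ V x + N * b := by
    have : (m : ℝ≥0) + m * b ≤ (V x + N * b) + m * b := by
      calc (m : ℝ≥0) + m * b = m * (b + 1) := by ring
        _ ≤ _ := h3
        _ = _ := by ring
    exact le_of_add_le_add_right this
  exact absurd hm (not_lt.2 h4)

/-- The **ergodic theorem** for a Markov chain with a Lyapunov function. -/
theorem exists_limit [Countable S] (H : IsErgodic P s V f b) (hne : s.Nonempty) :
    ∃ μ : PMF S, mean μ (fun y => (f y : ℝ≥0∞)) ≤ b + 1 ∧
      ∀ x ∈ s, ∀ h : S → ℝ≥0∞, (∀ y, h y ≤ 1) →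
        Tendsto (fun n => mean (iterLaw P x n) h) atTop (𝓝 (mean μ h)) := by
  classical
  obtain ⟨x₀, hx₀⟩ := hne
  have hfreq := H.frequently_mean_le hx₀
  -- An ultrafilter on the times with bounded mean of `f` gives all pointwise limits at once, by
  -- compactness of `ℝ≥0∞`, without a diagonal subsequence.
  set A : Set ℕ := {n | mean (iterLaw P x₀ n) (fun y => (f y : ℝ≥0∞)) ≤ b + 1} with hA
  have : NeBot (atTop ⊓ 𝓟 A) := frequently_mem_iff_neBot.1 hfreq
  set U : Ultrafilter ℕ := Ultrafilter.of (atTop ⊓ 𝓟 A) with hU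
  have hUle : (U : Filter ℕ) ≤ atTop ⊓ 𝓟 A := Ultrafilter.of_le _
  have hUtop : (U : Filter ℕ) ≤ atTop := hUle.trans inf_le_left
  have hUA : ∀ᶠ n in (U : Filter ℕ), n ∈ A := hUle.trans inf_le_right (mem_principal_self A)
  have hlim : ∀ y, ∃ c : ℝ≥0∞, Tendsto (fun n => iterLaw P x₀ n y) U (𝓝 c) := by
    intro y
    obtain ⟨c, -, hc⟩ := (isCompact_univ (X := ℝ≥0∞)).ultrafilter_le_nhds
      (U.map fun n => iterLaw P x₀ n y) (by simp)
    exact ⟨c, hc⟩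
  choose m hm using hlim
  have hsumF : ∀ F : Finset S, Tendsto (fun n => ∑ y ∈ F, iterLaw P x₀ n y) U
      (𝓝 (∑ y ∈ F, m y)) := fun F => tendsto_finsetSum _ fun y _ => hm y
  have hle : ∑' y, m y ≤ 1 := by
    rw [ENNReal.tsum_eq_iSup_sum]
    refine iSup_le fun F => le_of_tendsto' (hsumF F) fun n => ?_
    rw [← (iterLaw P x₀ n).tsum_coe]
    exact ENNReal.sum_le_tsum F
  have hge : 1 ≤ ∑' y, m y := by
    refine ENNReal.le_of_forall_pos_le_add fun ε hε _ => ?_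
    -- Markov's inequality: the mass outside `{f ≤ c}` is at most `(b + 1) / c = ε`, so no mass
    -- escapes in the limit.
    set c : ℝ≥0 := (b + 1) / ε with hc
    have hcpos : 0 < c := by positivity
    set F := (H.finite c).toFinset with hF
    refine le_trans ?_ (add_le_add_left (ENNReal.sum_le_tsum F) _)
    refine le_of_tendsto_of_tendsto tendsto_const_nhds ((hsumF F).add_const (ε : ℝ≥0∞)) ?_
    filter_upwards [hUA] with n hn
    have h1 : (1 : ℝ≥0∞) ≤ mean (iterLaw P x₀ n)
        (fun y => (if y ∈ F then 1 else 0) + (c : ℝ≥0∞)⁻¹ * f y) := by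
      refine (mean_const (iterLaw P x₀ n) 1).ge.trans (mean_mono fun y hy => ?_)
      by_cases hyF : y ∈ F
      · simp [hyF]
      · have hys := H.closed_iterLaw hx₀ n hy
        have : c < f y := by
          by_contra hcon
          exact hyF (by simpa [hF] using ⟨hys, not_lt.1 hcon⟩)
        rw [if_neg hyF, zero_add, ← ENNReal.div_eq_inv_mul,
          ENNReal.le_div_iff_mul_le (Or.inl (by simpa using hcpos.ne')) (Or.inl (by simp)), one_mul]
        exact_mod_cast this.le
    refine h1.trans ?_
    rw [mean_add, mean_const_mul]
    gcongr
    · unfold mean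
      rw [tsum_eq_sum (s := F)]
      · exact (Finset.sum_congr rfl fun y hy => by simp [hy]).le
      · intro y hy
        simp [hy]
    · calc (c : ℝ≥0∞)⁻¹ * mean (iterLaw P x₀ n) (fun y => (f y : ℝ≥0∞))
          ≤ (c : ℝ≥0∞)⁻¹ * (b + 1) := by gcongr; exact hn
        _ = ((c⁻¹ * (b + 1) : ℝ≥0) : ℝ≥0∞) := by
            rw [← ENNReal.coe_inv hcpos.ne']; push_cast; rfl
        _ = ε := by
            congr 1
            rw [hc]
            have : b + 1 ≠ 0 := by positivity
            field_simp
        _ ≤ ε := le_rfl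
  set μ : PMF S := ⟨m, by
    have := ENNReal.summable.hasSum (f := m)
    rwa [le_antisymm hle hge] at this⟩ with hμ
  have hμm : ∀ y, Tendsto (fun n => iterLaw P x₀ n y) U (𝓝 (μ y)) := hm
  have hμs : ∀ x, μ x ≠ 0 → x ∈ s := by
    intro x hx
    by_contra hxs
    refine hx (tendsto_nhds_unique (hμm x) ?_)
    refine tendsto_const_nhds.congr fun n => ?_
    by_contra hne
    exact hxs (H.closed_iterLaw hx₀ n (Ne.symm hne))
  have hpure : ∀ x ∈ s, ∀ y, PMF.pure x y ≠ 0 → y ∈ s := by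
    intro x hx y hy
    rw [← PMF.mem_support_iff, PMF.mem_support_pure_iff] at hy
    rwa [hy]
  -- Starting from `P x₀` shifts time by one, and the initial law is forgotten; so the laws at time
  -- `n + 1` have the same limit along `U`.
  have hinv : μ.bind P = μ := by
    refine bind_eq_of_tendsto hμm fun z => ?_
    have h1 := H.tendsto_of_tendsto (h := fun x => if x = z then 1 else 0)
      (fun x => by split_ifs <;> simp) (p := P x₀) (q := PMF.pure x₀)
      (H.closed x₀ hx₀) (hpure x₀ hx₀) hUtop (c := μ z)
      (by simpa only [PMF.pure_bind, mean_indicator] using hμm z)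
    simp only [← iterLaw_succ', mean_indicator] at h1
    exact h1
  refine ⟨μ, ?_, ?_⟩
  · exact mean_le_of_tendsto hμm (fun _ => ENNReal.coe_ne_top) hUA.frequently
  · intro x hx h hh
    have h1 := H.tendsto_of_tendsto hh (p := PMF.pure x) (q := μ) (hpure x hx) hμs le_rfl
      (c := mean μ h) (by simp only [bind_iterLaw hinv]; exact tendsto_const_nhds)
    simpa only [PMF.pure_bind] using h1

end IsErgodic

end MarkovChain

end QuantumSwitch

/-! ### Laws of links, swaps and yields; service rates -/

namespace QuantumSwitch

open Filter Topology

section IndependentVectors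

variable {ι : Type} [Fintype ι]

theorem indepVec_apply (μ : ι → PMF ℕ) (x : ι → ℕ) : indepVec μ x = ∏ i, μ i (x i) := by
  rw [indepVec, MeasureTheory.Measure.toPMF_apply, MeasureTheory.Measure.pi_singleton]
  exact Finset.prod_congr rfl fun i _ =>
    PMF.toMeasure_apply_singleton _ _ (measurableSet_singleton _)

theorem indepVec_ne_zero {μ : ι → PMF ℕ} {x : ι → ℕ} :
    indepVec μ x ≠ 0 ↔ ∀ i, μ i (x i) ≠ 0 := by
  simp [indepVec_apply, Finset.prod_ne_zero_iff]

theorem mean_indepVec_eval (μ : ι → PMF ℕ) (i : ι) (g : ℕ → ℝ≥0∞) :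
    mean (indepVec μ) (fun x => g (x i)) = mean (μ i) g := by
  rw [mean_eq_lintegral, mean_eq_lintegral, indepVec, MeasureTheory.Measure.toPMF_toMeasure]
  exact (MeasureTheory.measurePreserving_eval (fun i => (μ i).toMeasure) i).lintegral_comp
    (measurable_of_countable g)

theorem binomialPMF_apply (n : ℕ) (r : I) (k : ℕ) :
    binomialPMF n r k = ENNReal.ofReal ((n.choose k : ℝ) * r ^ k * (1 - r) ^ (n - k)) := by
  rw [binomialPMF, MeasureTheory.Measure.toPMF_apply, ProbabilityTheory.binomial_singleton]

theorem le_of_binomialPMF_ne_zero {n : ℕ} {r : I} {k : ℕ} (h : binomialPMF n r k ≠ 0) : k ≤ n := by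
  by_contra hk
  exact h (by simp [binomialPMF_apply, Nat.choose_eq_zero_of_lt (not_le.1 hk)])

end IndependentVectors

variable {K : ℕ} (sw : Params K)

theorem binomialTerm_nonneg (n k : ℕ) (r : I) :
    (0 : ℝ) ≤ (n.choose k : ℝ) * r ^ k * (1 - r) ^ (n - k) :=
  mul_nonneg (mul_nonneg (Nat.cast_nonneg _) (pow_nonneg r.2.1 _))
    (pow_nonneg (sub_nonneg.2 r.2.2) _)

theorem linkProb_nonneg (a : Fin K → ℕ) : 0 ≤ linkProb sw a :=
  Finset.prod_nonneg fun _ _ => binomialTerm_nonneg _ _ _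

theorem expectedYield_nonneg (x : ℕ) : 0 ≤ expectedYield sw x :=
  tsum_nonneg fun y => mul_nonneg (Nat.cast_nonneg y) ENNReal.toReal_nonneg

theorem hHat_nonneg (e : UserPair K) (m : ℕ) : 0 ≤ hHat sw e m := by
  refine Finset.sum_nonneg fun l _ => ?_
  rw [mul_assoc, mul_assoc, ← mul_assoc ((m.choose l : ℝ))]
  exact mul_nonneg (expectedYield_nonneg sw l) (binomialTerm_nonneg _ _ _)

theorem mean_yieldLaw (x : ℕ) :
    mean (sw.yieldLaw x) (fun y => (y : ℝ≥0∞)) = ENNReal.ofReal (expectedYield sw x) := by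
  have hz : ∀ y ∉ Finset.range (x + 1), sw.yieldLaw x y = 0 := by
    intro y hy
    by_contra hne
    exact hy (Finset.mem_range.2 (Nat.lt_succ_of_le (sw.yieldLaw_le x y hne)))
  rw [mean, expectedYield, tsum_eq_sum (s := Finset.range (x + 1)) (fun y hy => by simp [hz y hy]),
    tsum_eq_sum (s := Finset.range (x + 1)) (fun y hy => by simp [hz y hy]),
    ENNReal.ofReal_sum_of_nonneg fun y _ => mul_nonneg (Nat.cast_nonneg y) ENNReal.toReal_nonneg]
  refine Finset.sum_congr rfl fun y _ => ?_
  rw [ENNReal.ofReal_mul (Nat.cast_nonneg y), ENNReal.ofReal_natCast,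
    ENNReal.ofReal_toReal (PMF.apply_ne_top _ _), mul_comm]

theorem mean_binomialPMF_yield (e : UserPair K) (m : ℕ) :
    mean (binomialPMF m (sw.q e)) (fun l => ENNReal.ofReal (expectedYield sw l))
      = ENNReal.ofReal (hHat sw e m) := by
  rw [mean, tsum_eq_sum (s := Finset.range (m + 1)), hHat, ENNReal.ofReal_sum_of_nonneg]
  · refine Finset.sum_congr rfl fun l _ => ?_
    rw [binomialPMF_apply, ← ENNReal.ofReal_mul (binomialTerm_nonneg _ _ _)]
    congr 1
    ring
  · intro l _
    rw [mul_assoc, mul_assoc, ← mul_assoc ((m.choose l : ℝ))]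
    exact mul_nonneg (expectedYield_nonneg sw l) (binomialTerm_nonneg _ _ _)
  · intro l hl
    have : binomialPMF m (sw.q e) l = 0 := by
      by_contra hne
      exact hl (Finset.mem_range.2 (Nat.lt_succ_of_le (le_of_binomialPMF_ne_zero hne)))
    simp [this]

/-- No input pairs, no output. Idling therefore contributes no rate, and the term `a = 0` can be
left out of the region. -/
theorem hHat_zero (e : UserPair K) : hHat sw e 0 = 0 := by
  have h : expectedYield sw 0 = 0 := by
    refine (tsum_congr fun y => ?_).trans tsum_zero
    rcases Nat.eq_zero_or_pos y with rfl | hy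
    · simp
    · have : sw.yieldLaw 0 y = 0 := by
        by_contra hne
        exact absurd (sw.yieldLaw_le 0 y hne) (by omega)
      simp [this]
  simp [hHat, h]

/-- The law of the link level entanglements generated in a slot. -/
def linkLaw : PMF (Fin K → ℕ) := indepVec fun i => binomialPMF sw.alphaMax (sw.p i)

theorem linkLaw_apply (a : Fin K → ℕ) : linkLaw sw a = ENNReal.ofReal (linkProb sw a) := by
  rw [linkLaw, indepVec_apply, linkProb,
    ENNReal.ofReal_prod_of_nonneg fun i _ => binomialTerm_nonneg _ _ _]
  exact Finset.prod_congr rfl fun i _ => binomialPMF_apply _ _ _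

theorem mem_availabilities_of_linkLaw_ne_zero {a : Fin K → ℕ} (h : linkLaw sw a ≠ 0) :
    a ∈ availabilities sw := by
  rw [linkLaw, indepVec_ne_zero] at h
  exact Fintype.mem_piFinset.2 fun i =>
    Finset.mem_range.2 (Nat.lt_succ_of_le (le_of_binomialPMF_ne_zero (h i)))

theorem IsFeasible.mono {a : Fin K → ℕ} {π π' : PairVec K} (h : IsFeasible a π)
    (hle : ∀ e, π' e ≤ π e) : IsFeasible a π' :=
  fun j => (Finset.sum_le_sum fun e _ => hle e).trans (h j)

theorem IsFeasible.zero (a : Fin K → ℕ) : IsFeasible a (0 : PairVec K) := fun j => by simp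

theorem IsFeasible.le {a : Fin K → ℕ} {π : PairVec K} (h : IsFeasible a π) (e : UserPair K) :
    π e ≤ a e.1.1 :=
  (Finset.single_le_sum (f := π) (fun _ _ => Nat.zero_le _) (by simp)).trans (h e.1.1)

/-- The service rate of the pair `e` for swaps selected with the weights `β`. -/
def rateOf (β : (Fin K → ℕ) → PairVec K → ℝ) (e : UserPair K) : ℝ :=
  ∑ a ∈ availabilities sw with a ≠ 0,
    linkProb sw a * ∑ π ∈ allocations sw a, β a π * hHat sw e (π e)

/-- The mean yield of the pair `e` in a slot in which the swaps have the conditional law `κ`. -/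
def serviceRate (κ : (Fin K → ℕ) → PMF (PairVec K)) (e : UserPair K) : ℝ≥0∞ :=
  mean (linkLaw sw) fun a => mean (κ a) fun π => ENNReal.ofReal (hHat sw e (π e))

theorem serviceRate_eq (κ : (Fin K → ℕ) → PMF (PairVec K))
    (hκ : ∀ a ∈ availabilities sw, ∀ π, κ a π ≠ 0 → IsFeasible a π) (e : UserPair K) :
    serviceRate sw κ e = ENNReal.ofReal (rateOf sw (fun a π => (κ a π).toReal) e) := by
  have hnn : ∀ a π, 0 ≤ (κ a π).toReal * hHat sw e (π e) := fun a π =>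
    mul_nonneg ENNReal.toReal_nonneg (hHat_nonneg sw e _)
  have hinner : ∀ a ∈ availabilities sw, mean (κ a) (fun π => ENNReal.ofReal (hHat sw e (π e)))
      = ENNReal.ofReal (∑ π ∈ allocations sw a, (κ a π).toReal * hHat sw e (π e)) := by
    intro a ha
    rw [mean, tsum_eq_sum (s := allocations sw a),
      ENNReal.ofReal_sum_of_nonneg fun π _ => hnn a π]
    · refine Finset.sum_congr rfl fun π _ => ?_
      rw [ENNReal.ofReal_mul ENNReal.toReal_nonneg, ENNReal.ofReal_toReal (PMF.apply_ne_top _ _)]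
    · intro π hπ
      have : κ a π = 0 := by
        by_contra hne
        exact hπ ((mem_allocations sw ha π).2 (hκ a ha π hne))
      simp [this]
  rw [serviceRate, mean, tsum_eq_sum (s := {a ∈ availabilities sw | a ≠ 0}), rateOf,
    ENNReal.ofReal_sum_of_nonneg fun a _ => mul_nonneg (linkProb_nonneg sw a)
      (Finset.sum_nonneg fun π _ => hnn a π)]
  · refine Finset.sum_congr rfl fun a ha => ?_
    rw [linkLaw_apply, hinner a (Finset.mem_filter.1 ha).1,
      ENNReal.ofReal_mul (linkProb_nonneg sw a)]
  · intro a ha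
    by_cases hav : a ∈ availabilities sw
    · have ha0 : a = 0 := by
        by_contra hne
        exact ha (Finset.mem_filter.2 ⟨hav, hne⟩)
      have : mean (κ a) (fun π => ENNReal.ofReal (hHat sw e (π e))) = 0 := by
        rw [← mean_const (κ a) 0]
        refine mean_congr fun π hπ => ?_
        have h0 : π e = 0 := by
          have := (hκ a hav π hπ).le e
          simpa [ha0] using this
        simp [h0, hHat_zero]
      rw [this, mul_zero]
    · have : linkLaw sw a = 0 := by
        by_contra hne
        exact hav (mem_availabilities_of_linkLaw_ne_zero sw hne)
      rw [this, zero_mul]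

/-! ### The dynamics of one slot -/

variable (pol : Policy K) (Q : PairVec K)

/-- The conditional law of the number of swaps that are performed with the queue vector `Q`. -/
def swapLaw (a : Fin K → ℕ) : PMF (PairVec K) :=
  (pol.select Q a).map fun W e => min (W e) (Q e)

theorem swapLaw_feasible (a : Fin K → ℕ) (π : PairVec K) (h : swapLaw pol Q a π ≠ 0) :
    IsFeasible a π := by
  rw [← PMF.mem_support_iff, swapLaw, PMF.mem_support_map_iff] at h
  obtain ⟨W, hW, rfl⟩ := h
  exact (pol.feasible Q a W hW).mono fun e => min_le_left _ _

/-- The law of the vector of delivered pairs in a slot started with the queue vector `Q`. -/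
def deliveryLaw : PMF (PairVec K) :=
  (linkLaw sw).bind fun T =>
  (pol.select Q T).bind fun W =>
  (indepVec fun e => binomialPMF (min (W e) (Q e)) (sw.q e)).bind fun B =>
  indepVec fun e => sw.yieldLaw (B e)

theorem slot_eq (arr : UserPair K → PMF ℕ) : slot sw pol arr Q =
    (deliveryLaw sw pol Q).bind fun D => (indepVec arr).map fun A e => Q e - D e + A e := by
  simp only [slot, deliveryLaw, linkLaw, PMF.bind_bind, PMF.map]
  rfl

theorem mean_slot (arr : UserPair K → PMF ℕ) (f : PairVec K → ℝ≥0∞) :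
    mean (slot sw pol arr Q) f = mean (deliveryLaw sw pol Q) fun D =>
      mean (indepVec arr) fun A => f fun e => Q e - D e + A e := by
  simp only [slot_eq, mean_bind, mean_map]

theorem slot_ne_zero {arr : UserPair K → PMF ℕ} {x : PairVec K} :
    slot sw pol arr Q x ≠ 0 ↔ ∃ D A : PairVec K, deliveryLaw sw pol Q D ≠ 0 ∧ (∀ e, arr e (A e) ≠ 0) ∧
      x = fun e => Q e - D e + A e := by
  rw [← PMF.mem_support_iff, slot_eq, PMF.mem_support_bind_iff]
  constructor
  · rintro ⟨D, hD, hx⟩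
    obtain ⟨A, hA, rfl⟩ := (PMF.mem_support_map_iff _ _ _).1 hx
    exact ⟨D, A, hD, indepVec_ne_zero.1 hA, rfl⟩
  · rintro ⟨D, A, hD, hA, rfl⟩
    exact ⟨D, hD, (PMF.mem_support_map_iff _ _ _).2 ⟨A, indepVec_ne_zero.2 hA, rfl⟩⟩

/-- The first bound makes the truncated subtraction in the queue recursion exact; the second bounds
the second-order term of the quadratic drift. -/
theorem deliveryLaw_le {D : PairVec K} (h : deliveryLaw sw pol Q D ≠ 0) (e : UserPair K) :
    D e ≤ Q e ∧ D e ≤ sw.alphaMax := by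
  rw [← PMF.mem_support_iff] at h
  simp only [deliveryLaw, PMF.mem_support_bind_iff] at h
  obtain ⟨T, hT, W, hW, B, hB, hD⟩ := h
  rw [PMF.mem_support_iff, indepVec_ne_zero] at hB hD
  have h1 := sw.yieldLaw_le _ _ (hD e)
  have h2 := le_of_binomialPMF_ne_zero (hB e)
  have h3 := (pol.feasible Q T W hW).le e
  have h4 := Finset.mem_range.1 (Fintype.mem_piFinset.1
    (mem_availabilities_of_linkLaw_ne_zero sw hT) e.1.1)
  omega

theorem mean_deliveryLaw (e : UserPair K) :
    mean (deliveryLaw sw pol Q) (fun D => (D e : ℝ≥0∞)) = serviceRate sw (swapLaw pol Q) e := by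
  simp only [deliveryLaw, mean_bind, serviceRate, swapLaw, mean_map]
  congr 1
  funext T
  congr 1
  funext W
  simp only [mean_indepVec_eval (fun e => sw.yieldLaw _) e (fun y => (y : ℝ≥0∞)), mean_yieldLaw]
  rw [mean_indepVec_eval (fun e => binomialPMF (min (W e) (Q e)) (sw.q e)) e
    (fun l => ENNReal.ofReal (expectedYield sw l)), mean_binomialPMF_yield]

/-- Conservation of requests in a slot. -/
theorem mean_slot_add_serviceRate {r : ℝ≥0} {arr : UserPair K → PMF ℕ} {e : UserPair K}
    (harr : IsRequestLaw r (arr e)) :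
    mean (slot sw pol arr Q) (fun x => (x e : ℝ≥0∞)) + serviceRate sw (swapLaw pol Q) e
      = Q e + r := by
  have hA : mean (indepVec arr) (fun A => (A e : ℝ≥0∞)) = r := by
    rw [mean_indepVec_eval arr e (fun k => (k : ℝ≥0∞))]
    exact harr.mean_eq
  rw [mean_slot, ← mean_deliveryLaw, ← mean_add]
  have : ∀ D, deliveryLaw sw pol Q D ≠ 0 →
      mean (indepVec arr) (fun A => ((Q e - D e + A e : ℕ) : ℝ≥0∞)) + D e = Q e + r := by
    intro D hD
    have hle := (deliveryLaw_le sw pol Q hD e).1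
    simp only [Nat.cast_add]
    rw [mean_add, mean_const, hA, add_right_comm, ← Nat.cast_add, Nat.sub_add_cancel hle]
  rw [mean_congr this, mean_const]

end QuantumSwitch

/-! ### The explicit region and its supporting weights -/

namespace QuantumSwitch

open Filter Topology

variable {K : ℕ} (sw : Params K)

/-- `β` consists of nonnegative weights of total mass at most one for each availability vector. -/
def IsSubWeight (β : (Fin K → ℕ) → PairVec K → ℝ) : Prop :=
  ∀ a ∈ availabilities sw, (∀ π ∈ allocations sw a, 0 ≤ β a π) ∧ ∑ π ∈ allocations sw a, β a π ≤ 1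

theorem rateOf_add_smul (c d : ℝ) (β γ : (Fin K → ℕ) → PairVec K → ℝ) (e : UserPair K) :
    rateOf sw (fun a π => c * β a π + d * γ a π) e = c * rateOf sw β e + d * rateOf sw γ e := by
  simp only [rateOf, Finset.mul_sum, ← Finset.sum_add_distrib]
  refine Finset.sum_congr rfl fun a _ => Finset.sum_congr rfl fun π _ => ?_
  ring

theorem rateOf_nonneg {β : (Fin K → ℕ) → PairVec K → ℝ} (hβ : IsSubWeight sw β)
    (e : UserPair K) : 0 ≤ rateOf sw β e :=
  Finset.sum_nonneg fun a ha => mul_nonneg (linkProb_nonneg sw a) <| Finset.sum_nonneg fun π hπ =>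
    mul_nonneg ((hβ a (Finset.mem_filter.1 ha).1).1 π hπ) (hHat_nonneg sw e _)

theorem zero_mem_allocations {a : Fin K → ℕ} (ha : a ∈ availabilities sw) :
    (0 : PairVec K) ∈ allocations sw a :=
  (mem_allocations sw ha 0).2 (IsFeasible.zero a)

theorem isSubWeight_toReal (κ : (Fin K → ℕ) → PMF (PairVec K)) :
    IsSubWeight sw fun a π => (κ a π).toReal := by
  refine fun a _ => ⟨fun π _ => ENNReal.toReal_nonneg, ?_⟩
  rw [← ENNReal.toReal_sum fun π _ => PMF.apply_ne_top _ _, ← ENNReal.toReal_one]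
  refine ENNReal.toReal_mono ENNReal.one_ne_top ?_
  rw [← (κ a).tsum_coe]
  exact ENNReal.sum_le_tsum _

/-- Mixing in a little of the uniform weights of total mass `1 / 2` makes all weights positive and
all totals less than one. The strict slack pays for it; zero rates need none. -/
theorem mem_explicitRegion_of_lt {rate : UserPair K → ℝ≥0} {β : (Fin K → ℕ) → PairVec K → ℝ}
    (hβ : IsSubWeight sw β) (h : ∀ e, rate e ≠ 0 → (rate e : ℝ) < rateOf sw β e) :
    rate ∈ explicitRegion sw := by
  obtain ⟨η, hη0, hη1, hη⟩ : ∃ η : ℝ, 0 < η ∧ η < 1 ∧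
      ∀ e, rate e ≠ 0 → (rate e : ℝ) < (1 - η) * rateOf sw β e := by
    have hev : ∀ᶠ η : ℝ in 𝓝[>] 0, ∀ e, rate e ≠ 0 → (rate e : ℝ) < (1 - η) * rateOf sw β e := by
      rw [eventually_all]
      intro e
      by_cases he : rate e = 0
      · exact Eventually.of_forall fun _ hne => absurd he hne
      · have ht : Tendsto (fun η : ℝ => (1 - η) * rateOf sw β e) (𝓝[>] 0)
            (𝓝 ((1 - 0) * rateOf sw β e)) :=
          ((continuous_const.sub continuous_id).mul continuous_const).continuousAt.tendsto.mono_left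
            nhdsWithin_le_nhds
        rw [sub_zero, one_mul] at ht
        exact (ht.eventually_const_lt (h e he)).mono fun η hlt _ => hlt
    have h1 : ∀ᶠ η : ℝ in 𝓝[>] 0, η < 1 :=
      nhdsWithin_le_nhds (Iio_mem_nhds one_pos)
    obtain ⟨η, h2, h3, h4⟩ := (hev.and (h1.and self_mem_nhdsWithin)).exists
    exact ⟨η, h4, h3, h2⟩
  set γ : (Fin K → ℕ) → PairVec K → ℝ :=
    fun a _ => (2 * ((allocations sw a).card : ℝ))⁻¹ with hγ
  have hcard : ∀ a ∈ availabilities sw, 0 < ((allocations sw a).card : ℝ) := fun a ha =>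
    Nat.cast_pos.2 (Finset.card_pos.2 ⟨0, zero_mem_allocations sw ha⟩)
  have hγsum : ∀ a ∈ availabilities sw, ∑ π ∈ allocations sw a, γ a π = 1 / 2 := by
    intro a ha
    have := hcard a ha
    simp only [hγ, Finset.sum_const, nsmul_eq_mul]
    field_simp
  have hγpos : ∀ a ∈ availabilities sw, ∀ π, 0 < γ a π := fun a ha π => by
    have := hcard a ha
    simp only [hγ]
    positivity
  have hγw : IsSubWeight sw γ := fun a ha =>
    ⟨fun π _ => (hγpos a ha π).le, by rw [hγsum a ha]; norm_num⟩
  refine ⟨fun a π => (1 - η) * β a π + η * γ a π, fun e => ?_, fun a ha π hπ => ?_, fun a ha => ?_⟩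
  · change (rate e : ℝ) ≤ rateOf sw _ e
    rw [rateOf_add_smul]
    have h1 := mul_nonneg hη0.le (rateOf_nonneg sw hγw e)
    by_cases he : rate e = 0
    · have h2 := mul_nonneg (sub_nonneg.2 hη1.le) (rateOf_nonneg sw hβ e)
      rw [he, NNReal.coe_zero]
      linarith
    · linarith [hη e he]
  · have h1 := mul_nonneg (sub_nonneg.2 hη1.le) ((hβ a ha).1 π hπ)
    have h2 := mul_pos hη0 (hγpos a ha π)
    linarith
  · rw [Finset.sum_add_distrib, ← Finset.mul_sum, ← Finset.mul_sum, hγsum a ha]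
    have h1 := mul_le_mul_of_nonneg_left (hβ a ha).2 (sub_nonneg.2 hη1.le)
    linarith

theorem isSubWeight_convex {β γ : (Fin K → ℕ) → PairVec K → ℝ} (hβ : IsSubWeight sw β)
    (hγ : IsSubWeight sw γ) {c d : ℝ} (hc : 0 ≤ c) (hd : 0 ≤ d) (hcd : c + d = 1) :
    IsSubWeight sw fun a π => c * β a π + d * γ a π := by
  refine fun a ha => ⟨fun π hπ => add_nonneg (mul_nonneg hc ((hβ a ha).1 π hπ))
    (mul_nonneg hd ((hγ a ha).1 π hπ)), ?_⟩
  rw [Finset.sum_add_distrib, ← Finset.mul_sum, ← Finset.mul_sum]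
  have h1 := mul_le_mul_of_nonneg_left (hβ a ha).2 hc
  have h2 := mul_le_mul_of_nonneg_left (hγ a ha).2 hd
  linarith

/-- A rate vector outside the explicit region maximizes some nonnegative weighted service rate. -/
theorem exists_supporting_weights {rate : UserPair K → ℝ≥0} (h : rate ∉ explicitRegion sw) :
    ∃ w : UserPair K → ℝ≥0, (∃ e, rate e ≠ 0 ∧ w e ≠ 0) ∧
      ∀ β, IsSubWeight sw β → ∑ e, (w e : ℝ) * rateOf sw β e ≤ ∑ e, (w e : ℝ) * rate e := by
  classical
  -- Coordinates with zero rate are unconstrained. This keeps `C` open and forces the separating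
  -- functional to vanish there.
  set C : Set (UserPair K → ℝ) := {v | ∃ β, IsSubWeight sw β ∧
    ∀ e, rate e ≠ 0 → v e < rateOf sw β e} with hC
  have hopen : IsOpen C := by
    have : C = ⋃ β ∈ {β | IsSubWeight sw β},
        ⋂ e ∈ {e | rate e ≠ 0}, {v : UserPair K → ℝ | v e < rateOf sw β e} := by
      ext v
      simp [hC]
    rw [this]
    refine isOpen_biUnion fun β _ => Set.Finite.isOpen_biInter (Set.toFinite _) fun e _ => ?_
    exact isOpen_lt (continuous_apply e) continuous_const
  have hconv : Convex ℝ C := by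
    rintro v ⟨β, hβ, hv⟩ u ⟨γ, hγ, hu⟩ c d hc hd hcd
    refine ⟨_, isSubWeight_convex sw hβ hγ hc hd hcd, fun e he => ?_⟩
    rw [rateOf_add_smul]
    simp only [Pi.add_apply, Pi.smul_apply, smul_eq_mul]
    rcases hc.eq_or_lt with rfl | hc
    · have : d = 1 := by linarith
      subst this
      linarith [hu e he]
    · have h1 := mul_lt_mul_of_pos_left (hv e he) hc
      have h2 := mul_le_mul_of_nonneg_left (hu e he).le hd
      linarith
  have hnot : (fun e => (rate e : ℝ)) ∉ C := by
    rintro ⟨β, hβ, hlt⟩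
    exact h (mem_explicitRegion_of_lt sw hβ hlt)
  obtain ⟨f, hf⟩ := geometric_hahn_banach_open_point hconv hopen hnot
  set u : UserPair K → ℝ := fun e => f (Pi.single e 1) with hu
  have hfv : ∀ v : UserPair K → ℝ, f v = ∑ e, u e * v e := by
    intro v
    conv_lhs => rw [pi_eq_sum_univ' v]
    rw [map_sum]
    refine Finset.sum_congr rfl fun e _ => ?_
    rw [map_smul, smul_eq_mul, mul_comm]
  have hmem : ∀ β, IsSubWeight sw β → ∀ δ : ℝ, 0 < δ → (fun e => rateOf sw β e - δ) ∈ C :=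
    fun β hβ δ hδ => ⟨β, hβ, fun e _ => by linarith⟩
  have hzero : IsSubWeight sw fun _ _ => 0 := fun a _ => ⟨fun _ _ => le_rfl, by simp⟩
  have hshift : ∀ v ∈ C, ∀ e, ∀ t : ℝ, (t ≤ 0 ∨ rate e = 0) → v + t • Pi.single e (1 : ℝ) ∈ C := by
    rintro v ⟨β, hβ, hv⟩ e t ht
    refine ⟨β, hβ, fun e' he' => ?_⟩
    have h1 := hv e' he'
    by_cases hee : e' = e
    · subst hee
      have h2 : t ≤ 0 := ht.resolve_right he'
      simp
      linarith
    · simpa [Pi.single_apply, hee] using h1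
  have hray : ∀ e, ∀ t : ℝ, (t ≤ 0 ∨ rate e = 0) →
      ∀ v ∈ C, f v + t * u e < f fun e => (rate e : ℝ) := by
    intro e t ht v hv
    have h1 := hf _ (hshift v hv e t ht)
    rwa [map_add, map_smul, smul_eq_mul] at h1
  have hv₀ := hmem _ hzero 1 one_pos
  have hu0 : ∀ e, 0 ≤ u e := by
    intro e
    by_contra hneg
    rw [not_le] at hneg
    -- This multiple of the basis vector would carry the functional exactly to its value at `rate`,
    -- contradicting strict separation.
    have h1 := hray e (((f fun e => (rate e : ℝ)) - f (fun e => rateOf sw (fun _ _ => 0) e - 1)) / u e)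
      (Or.inl (div_nonpos_of_nonneg_of_nonpos (sub_nonneg.2 (hf _ hv₀).le) hneg.le)) _ hv₀
    rw [div_mul_cancel₀ _ hneg.ne] at h1
    linarith
  have hu1 : ∀ e, rate e = 0 → u e = 0 := by
    intro e he
    by_contra hne
    have h1 := hray e (((f fun e => (rate e : ℝ)) - f (fun e => rateOf sw (fun _ _ => 0) e - 1)) / u e)
      (Or.inr he) _ hv₀
    rw [div_mul_cancel₀ _ hne] at h1
    linarith
  refine ⟨fun e => ⟨u e, hu0 e⟩, ?_, fun β hβ => ?_⟩
  · by_contra hcon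
    push Not at hcon
    have hall : ∀ e, u e = 0 := fun e => by
      by_cases he : rate e = 0
      · exact hu1 e he
      · exact congrArg NNReal.toReal (hcon e he)
    have h1 := hf _ hv₀
    rw [hfv, hfv] at h1
    simp [hall] at h1
  · change ∑ e, u e * rateOf sw β e ≤ ∑ e, u e * (rate e : ℝ)
    have h1 : ∀ δ : ℝ, 0 < δ → ∑ e, u e * rateOf sw β e - δ * ∑ e, u e
        < ∑ e, u e * (rate e : ℝ) := by
      intro δ hδ
      have h2 := hf _ (hmem β hβ δ hδ)
      rw [hfv, hfv] at h2
      refine lt_of_eq_of_lt ?_ h2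
      rw [Finset.mul_sum, ← Finset.sum_sub_distrib]
      exact Finset.sum_congr rfl fun e _ => by ring
    have ht : Tendsto (fun δ : ℝ => ∑ e, u e * rateOf sw β e - δ * ∑ e, u e) (𝓝[>] 0)
        (𝓝 (∑ e, u e * rateOf sw β e - 0 * ∑ e, u e)) :=
      (continuous_const.sub (continuous_id.mul continuous_const)).continuousAt.tendsto.mono_left
        nhdsWithin_le_nhds
    rw [zero_mul, sub_zero] at ht
    exact le_of_tendsto ht (eventually_mem_nhdsWithin.mono fun δ hδ => (h1 δ hδ).le)

/-! ### Necessity: stable rates lie in the region -/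

theorem tendsto_apply_of_tendsto {p : ℕ → PMF (PairVec K)} {μ : PMF (PairVec K)}
    (h : Tendsto (fun n => asProbabilityMeasure (p n)) atTop (𝓝 (asProbabilityMeasure μ)))
    (x : PairVec K) : Tendsto (fun n => p n x) atTop (𝓝 (μ x)) := by
  have h1 := MeasureTheory.ProbabilityMeasure.tendsto_measure_of_null_frontier_of_tendsto' h
    (E := {x}) (by rw [(isClopen_discrete ({x} : Set (PairVec K))).frontier_eq]; simp)
  have h2 : ∀ p : PMF (PairVec K),
      (asProbabilityMeasure p : MeasureTheory.Measure (PairVec K)) {x} = p x := fun p =>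
    PMF.toMeasure_apply_singleton _ _ (measurableSet_singleton _)
  simpa only [h2] using h1

variable {sw}

/-- The weighted backlog would be a nonnegative martingale in stationarity, yet constant over a slot
started at its minimum, against the randomness of the arrivals. -/
theorem mem_explicitRegion_of_isStable {rate : UserPair K → ℝ≥0} {arr : UserPair K → PMF ℕ}
    (harr : ∀ e, IsRequestLaw (rate e) (arr e)) {pol : Policy K}
    (hst : IsStable sw pol rate arr) : rate ∈ explicitRegion sw := by
  classical
  by_contra hnot
  obtain ⟨w, ⟨e₀, hre₀, hwe₀⟩, hw⟩ := exists_supporting_weights sw hnot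
  obtain ⟨μ, hμ, hfin⟩ := hst
  have hlim := tendsto_apply_of_tendsto (hμ 0 fun _ _ => rfl)
  have hinv : μ.bind (slot sw pol arr) = μ :=
    bind_eq_of_tendsto hlim fun x => (hlim x).comp (tendsto_add_atTop_nat 1)
  set f : PairVec K → ℝ≥0 := fun x => ∑ e, w e * x e with hf
  set g : PairVec K → ℝ≥0∞ := fun Q => ∑ e, w e * serviceRate sw (swapLaw pol Q) e with hg
  set c : ℝ≥0 := ∑ e, w e * rate e with hc
  have hfcoe : ∀ x, (f x : ℝ≥0∞) = ∑ e, (w e : ℝ≥0∞) * (x e : ℝ≥0∞) := fun x => by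
    simp [hf]
  have hdrift : ∀ Q, mean (slot sw pol arr Q) (fun x => (f x : ℝ≥0∞)) + g Q = f Q + c := by
    intro Q
    simp only [hfcoe, hg, hc, mean_sum, mean_const_mul, ← Finset.sum_add_distrib, ← mul_add,
      mean_slot_add_serviceRate sw pol Q (harr _), ENNReal.ofNNReal_finsetSum, ENNReal.coe_mul]
  have hgle : ∀ Q, g Q ≤ c := by
    intro Q
    have h1 := hw _ (isSubWeight_toReal sw (swapLaw pol Q))
    have hnn : ∀ e, 0 ≤ rateOf sw (fun a π => (swapLaw pol Q a π).toReal) e := fun e =>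
      rateOf_nonneg sw (isSubWeight_toReal sw _) e
    have h2 := ENNReal.ofReal_le_ofReal h1
    rw [ENNReal.ofReal_sum_of_nonneg fun e _ => mul_nonneg (NNReal.coe_nonneg _) (hnn e)] at h2
    simp only [ENNReal.ofReal_mul (NNReal.coe_nonneg _), ENNReal.ofReal_coe_nnreal,
      ← serviceRate_eq sw (swapLaw pol Q) (fun a _ => swapLaw_feasible pol Q a)] at h2
    refine h2.trans (le_of_eq ?_)
    rw [← ENNReal.ofReal_coe_nnreal, hc]
    congr 1
    push_cast
    rfl
  have hmfin : mean μ (fun x => (f x : ℝ≥0∞)) ≠ ⊤ := by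
    simp only [hfcoe, mean_sum, mean_const_mul]
    exact ENNReal.sum_ne_top.2 fun e _ => ENNReal.mul_ne_top ENNReal.coe_ne_top (hfin e)
  have hmg : mean μ g = c := by
    have h1 : mean μ (fun Q => mean (slot sw pol arr Q) (fun x => (f x : ℝ≥0∞)) + g Q)
        = mean μ (fun Q => (f Q : ℝ≥0∞) + c) := mean_congr fun Q _ => hdrift Q
    rw [mean_add, mean_add, mean_const, ← mean_bind, hinv] at h1
    exact (ENNReal.add_right_inj hmfin).1 h1
  have hgeq : ∀ Q, μ Q ≠ 0 → g Q = c := fun Q hQ =>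
    (eq_of_mean_le (p := μ) (f := fun _ => (c : ℝ≥0∞)) (g := g) (fun Q _ => hgle Q)
      (by rw [hmg]; exact ENNReal.coe_ne_top) (by rw [mean_const, hmg]) Q hQ).symm
  have hmono : Monotone f := fun x y hxy =>
    Finset.sum_le_sum fun e _ => mul_le_mul_right (Nat.cast_le.2 (hxy e)) _
  -- By Dickson's lemma the image of a set of queue vectors under the monotone `f` is well-founded,
  -- even though `f` has real weights, some possibly zero.
  have hwf : (f '' μ.support).IsWF :=
    ((Set.isPWO_of_wellQuasiOrderedLE μ.support).image_of_monotone hmono).isWF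
  have hne : (f '' μ.support).Nonempty := μ.support_nonempty.image f
  obtain ⟨Q₀, hQ₀, hQ₀min⟩ := hwf.min_mem hne
  have hmin : ∀ x, μ x ≠ 0 → f Q₀ ≤ f x := fun x hx => by
    rw [hQ₀min]
    exact hwf.min_le hne ⟨x, hx, rfl⟩
  have hclosed : ∀ x, slot sw pol arr Q₀ x ≠ 0 → μ x ≠ 0 := by
    intro x hx
    rw [← PMF.mem_support_iff, ← hinv, PMF.mem_support_bind_iff]
    exact ⟨Q₀, hQ₀, hx⟩
  have hconst : ∀ x, slot sw pol arr Q₀ x ≠ 0 → f x = f Q₀ := by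
    intro x hx
    have h1 : mean (slot sw pol arr Q₀) (fun x => (f x : ℝ≥0∞)) = f Q₀ := by
      have := hdrift Q₀
      rw [hgeq Q₀ hQ₀] at this
      exact (ENNReal.add_left_inj ENNReal.coe_ne_top).1 this
    have h2 := eq_of_mean_le (p := slot sw pol arr Q₀) (f := fun x => (f x : ℝ≥0∞))
      (g := fun _ => (f Q₀ : ℝ≥0∞)) (fun x hx => by exact_mod_cast hmin x (hclosed x hx))
      (by rw [mean_const]; exact ENNReal.coe_ne_top) (by rw [mean_const, h1]) x hx
    exact_mod_cast h2
  obtain ⟨D, hD⟩ := (deliveryLaw sw pol Q₀).support_nonempty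
  obtain ⟨A, hA⟩ := (indepVec arr).support_nonempty
  rw [PMF.mem_support_iff] at hD
  rw [PMF.mem_support_iff, indepVec_ne_zero] at hA
  -- Modulus 2 serves only to provide two distinct arrival numbers of positive probability.
  obtain ⟨k, l, hk, hl, hkl⟩ := (harr e₀).span_one hre₀ 2 le_rfl
  have hval : ∀ m, arr e₀ m ≠ 0 →
      f (fun e => Q₀ e - D e + Function.update A e₀ m e) = f Q₀ := by
    intro m hm
    refine hconst _ ((slot_ne_zero sw pol Q₀).2 ⟨D, Function.update A e₀ m, hD, fun e => ?_, rfl⟩)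
    by_cases he : e = e₀
    · subst he
      simpa using hm
    · simpa [he] using hA e
  have heq := (hval k hk).trans (hval l hl).symm
  simp only [hf] at heq
  rw [← Finset.add_sum_erase _ _ (Finset.mem_univ e₀),
    ← Finset.add_sum_erase _ _ (Finset.mem_univ e₀)] at heq
  have hrest : ∀ m, ∑ e ∈ Finset.univ.erase e₀,
      w e * ((Q₀ e - D e + Function.update A e₀ m e : ℕ) : ℝ≥0)
      = ∑ e ∈ Finset.univ.erase e₀, w e * ((Q₀ e - D e + A e : ℕ) : ℝ≥0) := fun m =>
    Finset.sum_congr rfl fun e he => by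
      rw [Function.update_of_ne (Finset.ne_of_mem_erase he)]
  rw [hrest, hrest, add_left_inj, Function.update_self, Function.update_self] at heq
  have h1 := mul_left_cancel₀ hwe₀ heq
  have h2 : k = l := by
    have := Nat.cast_injective h1
    omega
  exact hkl (h2 ▸ rfl)

end QuantumSwitch

/-! ### Sufficiency: a static policy with spare service -/

namespace QuantumSwitch

open Filter Topology

variable {K : ℕ} {sw : Params K}

/-- The policy that ignores the queue vector. -/
def staticPolicy (κ : (Fin K → ℕ) → PMF (PairVec K))
    (hκ : ∀ a, ∀ π ∈ (κ a).support, IsFeasible a π) : Policy K where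
  select _ a := κ a
  feasible _ a := hκ a

/-- A rate vector in the explicit region is strictly exceeded by the service rates of a queue
oblivious choice of the swaps that idles with positive probability. -/
theorem exists_swap_laws {rate : UserPair K → ℝ≥0} (h : rate ∈ explicitRegion sw) :
    ∃ κ : (Fin K → ℕ) → PMF (PairVec K), (∀ a, ∀ π ∈ (κ a).support, IsFeasible a π) ∧
      (∀ a, κ a 0 ≠ 0) ∧ ∀ e, rate e ≠ 0 → (rate e : ℝ≥0∞) < serviceRate sw κ e := by
  classical
  obtain ⟨b, hrate, hpos, hsum⟩ := h
  obtain ⟨η, hη0, hη⟩ : ∃ η : ℝ, 0 < η ∧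
      ∀ a ∈ availabilities sw, (1 + η) * ∑ π ∈ allocations sw a, b a π < 1 := by
    have hev : ∀ᶠ η : ℝ in 𝓝[>] 0,
        ∀ a ∈ availabilities sw, (1 + η) * ∑ π ∈ allocations sw a, b a π < 1 := by
      rw [Finset.eventually_all]
      intro a ha
      have ht : Tendsto (fun η : ℝ => (1 + η) * ∑ π ∈ allocations sw a, b a π) (𝓝[>] 0)
          (𝓝 ((1 + 0) * ∑ π ∈ allocations sw a, b a π)) :=
        ((continuous_const.add continuous_id).mul continuous_const).continuousAt.tendsto.mono_left
          nhdsWithin_le_nhds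
      rw [add_zero, one_mul] at ht
      exact ht.eventually_lt_const (hsum a ha)
    obtain ⟨η, h1, h2⟩ := (hev.and eventually_mem_nhdsWithin).exists
    exact ⟨η, h2, h1⟩
  -- The mass left over after scaling goes to idling, which changes no service rate and makes `κ a
  -- 0` positive.
  set idle : (Fin K → ℕ) → PairVec K → ℝ := fun a π =>
    if π = 0 then 1 - (1 + η) * ∑ π ∈ allocations sw a, b a π else 0 with hidle
  set c : (Fin K → ℕ) → PairVec K → ℝ := fun a π => (1 + η) * b a π + 1 * idle a π with hc
  have hidle0 : ∀ a ∈ availabilities sw, ∀ π, 0 ≤ idle a π := by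
    intro a ha π
    simp only [hidle]
    split_ifs
    · linarith [hη a ha]
    · exact le_rfl
  have hcpos : ∀ a ∈ availabilities sw, ∀ π ∈ allocations sw a, 0 < c a π := by
    intro a ha π hπ
    have h1 := mul_pos (by linarith : (0 : ℝ) < 1 + η) (hpos a ha π hπ)
    have h2 := hidle0 a ha π
    simp only [hc]
    linarith
  have hcsum : ∀ a ∈ availabilities sw, ∑ π ∈ allocations sw a, c a π = 1 := by
    intro a ha
    simp only [hc, hidle, one_mul, Finset.sum_add_distrib, ← Finset.mul_sum]
    rw [Finset.sum_ite_eq' (allocations sw a) 0, if_pos (zero_mem_allocations sw ha)]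
    ring
  have hcidle : ∀ e, rateOf sw idle e = 0 := by
    intro e
    refine Finset.sum_eq_zero fun a _ => ?_
    rw [Finset.sum_eq_zero, mul_zero]
    intro π _
    by_cases hπ : π = 0
    · rw [hπ, Pi.zero_apply, hHat_zero, mul_zero]
    · simp [hidle, hπ]
  have hpmf : ∀ a, ∃ p : PMF (PairVec K), (∀ π ∈ p.support, IsFeasible a π) ∧ p 0 ≠ 0 ∧
      (a ∈ availabilities sw → ∀ π ∈ allocations sw a, (p π).toReal = c a π) := by
    intro a
    by_cases ha : a ∈ availabilities sw
    · refine ⟨PMF.ofFinset (fun π => if π ∈ allocations sw a then ENNReal.ofReal (c a π) else 0)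
        (allocations sw a) ?_ fun π hπ => if_neg hπ, fun π hπ => ?_, ?_, fun _ π hπ => ?_⟩
      · rw [Finset.sum_congr rfl fun π hπ => if_pos hπ,
          ← ENNReal.ofReal_sum_of_nonneg fun π hπ => (hcpos a ha π hπ).le, hcsum a ha,
          ENNReal.ofReal_one]
      · rw [PMF.support_ofFinset] at hπ
        exact (mem_allocations sw ha π).1 hπ.1
      · rw [PMF.ofFinset_apply, if_pos (zero_mem_allocations sw ha)]
        exact (ENNReal.ofReal_pos.2 (hcpos a ha 0 (zero_mem_allocations sw ha))).ne'
      · rw [PMF.ofFinset_apply, if_pos hπ, ENNReal.toReal_ofReal (hcpos a ha π hπ).le]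
    · refine ⟨PMF.pure 0, fun π hπ => ?_, by simp, fun h => absurd h ha⟩
      rw [(PMF.mem_support_pure_iff _ _).1 hπ]
      exact IsFeasible.zero a
  choose κ hfeas hκ0 hκc using hpmf
  refine ⟨κ, hfeas, hκ0, fun e he => ?_⟩
  rw [serviceRate_eq sw κ (fun a _ π hπ => hfeas a π hπ)]
  have heq : rateOf sw (fun a π => (κ a π).toReal) e = (1 + η) * rateOf sw b e := by
    have h1 : rateOf sw (fun a π => (κ a π).toReal) e = rateOf sw c e := by
      refine Finset.sum_congr rfl fun a ha => ?_
      congr 1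
      refine Finset.sum_congr rfl fun π hπ => ?_
      exact congrArg (· * _) (hκc a (Finset.mem_filter.1 ha).1 π hπ)
    rw [h1, hc, rateOf_add_smul, hcidle, mul_zero, add_zero]
  have hr : (0 : ℝ) < rate e := NNReal.coe_pos.2 (pos_iff_ne_zero.2 he)
  have hle : (rate e : ℝ) ≤ rateOf sw b e := hrate e
  rw [heq, ← ENNReal.ofReal_coe_nnreal,
    ENNReal.ofReal_lt_ofReal_iff (mul_pos (by linarith) (hr.trans_le hle))]
  nlinarith

theorem queueLaw_eq_iterLaw (pol : Policy K) (arr : UserPair K → PMF ℕ) (x : PairVec K) (n : ℕ) :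
    queueLaw sw pol arr x n = iterLaw (slot sw pol arr) x n := by
  induction n with
  | zero => rfl
  | succ n ih => rw [queueLaw, iterLaw, ih]

theorem IsRequestLaw.eq_zero {ν : PMF ℕ} (h : IsRequestLaw 0 ν) {k : ℕ} (hk : ν k ≠ 0) :
    k = 0 := by
  have h1 := h.mean_eq
  rw [ENNReal.coe_zero, ENNReal.tsum_eq_zero] at h1
  simpa [hk] using h1 k

theorem deliveryLaw_zero_ne_zero {pol : Policy K} (Q : PairVec K)
    (h : ∀ a, pol.select Q a 0 ≠ 0) : deliveryLaw sw pol Q 0 ≠ 0 := by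
  obtain ⟨T, hT⟩ := (linkLaw sw).support_nonempty
  rw [← PMF.mem_support_iff]
  simp only [deliveryLaw, PMF.mem_support_bind_iff]
  refine ⟨T, hT, 0, h T, 0, ?_, ?_⟩
  · rw [PMF.mem_support_iff, indepVec_ne_zero]
    intro e
    simp [binomialPMF_apply]
  · rw [PMF.mem_support_iff, indepVec_ne_zero]
    intro e
    obtain ⟨y, hy⟩ := (sw.yieldLaw 0).support_nonempty
    have := sw.yieldLaw_le 0 y hy
    obtain rfl : y = 0 := by omega
    exact hy

/-! ### Two copies of the chain can meet -/

section Meeting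

variable {arr : UserPair K → PMF ℕ}

/-- While both copies deliver nothing, their difference moves by differences of possible arrival
vectors. These generate every integer vector supported on the pairs of positive rate. -/
theorem meet_of_idle {pol : Policy K} (hidle : ∀ Q a, pol.select Q a 0 ≠ 0)
    {rate : UserPair K → ℝ≥0} (harr : ∀ e, IsRequestLaw (rate e) (arr e)) {x y : PairVec K}
    (hx : ∀ e, rate e = 0 → x e = 0) (hy : ∀ e, rate e = 0 → y e = 0) :
    ∃ z, Relation.ReflTransGen (fun v w : PairVec K × PairVec K =>
      slot sw pol arr v.1 w.1 ≠ 0 ∧ slot sw pol arr v.2 w.2 ≠ 0) (x, y) (z, z) := by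
  classical
  set r := fun v w : PairVec K × PairVec K =>
      slot sw pol arr v.1 w.1 ≠ 0 ∧ slot sw pol arr v.2 w.2 ≠ 0 with hr
  have hslot : ∀ Q A : PairVec K, (∀ e, arr e (A e) ≠ 0) → slot sw pol arr Q (Q + A) ≠ 0 :=
    fun Q A hA => (slot_ne_zero sw pol Q).2
      ⟨0, A, deliveryLaw_zero_ne_zero Q (hidle Q), hA, by funext e; simp⟩
  set L : AddSubgroup (UserPair K → ℤ) := AddSubgroup.closure
    {v | ∃ A A' : PairVec K, (∀ e, arr e (A e) ≠ 0) ∧ (∀ e, arr e (A' e) ≠ 0) ∧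
      v = fun e => (A e : ℤ) - A' e} with hL
  have hreach : ∀ v ∈ L, ∀ x y : PairVec K, ∃ x' y', Relation.ReflTransGen r (x, y) (x', y') ∧
      ∀ e, (x' e : ℤ) - y' e = x e - y e + v e := by
    intro v hv
    induction hv using AddSubgroup.closure_induction with
    | mem v hv =>
      obtain ⟨A, A', hA, hA', rfl⟩ := hv
      intro x y
      refine ⟨x + A, y + A', Relation.ReflTransGen.single ⟨hslot x A hA, hslot y A' hA'⟩,
        fun e => ?_⟩
      simp only [Pi.add_apply, Nat.cast_add]
      ring
    | zero => exact fun x y => ⟨x, y, .refl, fun e => by simp⟩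
    | add v w _ _ ihv ihw =>
      intro x y
      obtain ⟨x₁, y₁, h₁, e₁⟩ := ihv x y
      obtain ⟨x₂, y₂, h₂, e₂⟩ := ihw x₁ y₁
      refine ⟨x₂, y₂, h₁.trans h₂, fun e => ?_⟩
      rw [e₂, e₁, Pi.add_apply, add_assoc]
    -- A negative displacement is obtained by exchanging the roles of the two copies.
    | neg v _ ih =>
      intro x y
      obtain ⟨y', x', h₁, e₁⟩ := ih y x
      refine ⟨x', y', Relation.ReflTransGen.lift (p := r) Prod.swap (fun _ _ h => ⟨h.2, h.1⟩) _ _ h₁,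
        fun e => ?_⟩
      have := e₁ e
      rw [Pi.neg_apply]
      linarith
  obtain ⟨A, hA⟩ := (indepVec arr).support_nonempty
  rw [PMF.mem_support_iff, indepVec_ne_zero] at hA
  have hsingle : ∀ e, rate e ≠ 0 → ∀ t : ℤ, Pi.single e t ∈ L := by
    intro e he
    set H : AddSubgroup ℤ := L.comap (AddMonoidHom.single (fun _ : UserPair K => ℤ) e) with hH
    have hdiff : ∀ k l, arr e k ≠ 0 → arr e l ≠ 0 → (l : ℤ) - k ∈ H := by
      intro k l hk hl
      refine AddSubgroup.subset_closure ⟨Function.update A e l, Function.update A e k, ?_, ?_, ?_⟩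
      · intro e'
        by_cases h : e' = e
        · subst h; simpa using hl
        · simpa [h] using hA e'
      · intro e'
        by_cases h : e' = e
        · subst h; simpa using hk
        · simpa [h] using hA e'
      · funext e'
        by_cases h : e' = e
        · subst h; simp
        · simp [h]
    obtain ⟨d, hd⟩ := Int.subgroup_cyclic H
    rw [← AddSubgroup.zmultiples_eq_closure] at hd
    have hdvd : ∀ k l, arr e k ≠ 0 → arr e l ≠ 0 → (d.natAbs : ℤ) ∣ (l : ℤ) - k := by
      intro k l hk hl
      have := hdiff k l hk hl
      rw [hd, Int.mem_zmultiples_iff] at this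
      rwa [Int.natAbs_dvd]
    -- The generator `d` divides all differences of arrival numbers. The residue condition excludes
    -- `|d| ≥ 2` directly, and `d = 0` through modulus 2.
    have hd1 : d.natAbs = 1 := by
      by_contra hne
      rcases Nat.lt_or_ge d.natAbs 2 with h2 | h2
      · obtain ⟨k, l, hk, hl, hkl⟩ := (harr e).span_one he 2 le_rfl
        have := hdvd k l hk hl
        rw [show d.natAbs = 0 by omega, Nat.cast_zero, zero_dvd_iff] at this
        exact hkl (by rw [show k = l by omega])
      · obtain ⟨k, l, hk, hl, hkl⟩ := (harr e).span_one he d.natAbs h2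
        exact hkl (Nat.modEq_iff_dvd.2 (hdvd k l hk hl))
    intro t
    change t ∈ H
    rw [hd, Int.mem_zmultiples_iff, ← Int.natAbs_dvd, hd1]
    exact one_dvd t
  have hmem : (fun e => (y e : ℤ) - x e) ∈ L := by
    rw [← Finset.univ_sum_single fun e => (y e : ℤ) - x e]
    refine sum_mem fun e _ => ?_
    by_cases he : rate e = 0
    · rw [hx e he, hy e he, sub_self, Pi.single_zero]
      exact L.zero_mem
    · exact hsingle e he _
  obtain ⟨x', y', hpath, heq⟩ := hreach _ hmem x y
  obtain rfl : x' = y' := by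
    funext e
    have := heq e
    omega
  exact ⟨x', hpath⟩

end Meeting

/-! ### Quadratic drift and stability -/

/-- The drift of the squared queue length of a pair. -/
theorem mean_slot_sq_add_le {pol : Policy K} {r : ℝ≥0} {arr : UserPair K → PMF ℕ}
    {e : UserPair K} (harr : IsRequestLaw r (arr e)) (Q : PairVec K) :
    mean (slot sw pol arr Q) (fun x => (x e : ℝ≥0∞) ^ 2)
      + 2 * Q e * serviceRate sw (swapLaw pol Q) e
      ≤ (Q e : ℝ≥0∞) ^ 2 + 2 * Q e * r
        + ((sw.alphaMax : ℝ≥0∞) ^ 2 + mean (arr e) fun k => (k : ℝ≥0∞) ^ 2) := by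
  have hA : mean (indepVec arr) (fun A => (A e : ℝ≥0∞)) = r := by
    rw [mean_indepVec_eval arr e (fun k => (k : ℝ≥0∞))]
    exact harr.mean_eq
  have hA2 : mean (indepVec arr) (fun A => (A e : ℝ≥0∞) ^ 2)
      = mean (arr e) fun k => (k : ℝ≥0∞) ^ 2 :=
    mean_indepVec_eval arr e (fun k => (k : ℝ≥0∞) ^ 2)
  rw [mean_slot, ← mean_deliveryLaw, ← mean_const_mul, ← mean_add, ← hA2, ← hA]
  refine (mean_mono fun D hD => ?_).trans (mean_const (deliveryLaw sw pol Q) _).le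
  obtain ⟨h1, h2⟩ := deliveryLaw_le sw pol Q hD e
  rw [← mean_const (indepVec arr) (2 * (Q e : ℝ≥0∞) * D e), ← mean_add, ← mean_const_mul,
    ← mean_const (indepVec arr) ((sw.alphaMax : ℝ≥0∞) ^ 2), ← mean_add,
    ← mean_const (indepVec arr) ((Q e : ℝ≥0∞) ^ 2), ← mean_add, ← mean_add]
  refine mean_mono fun A _ => ?_
  -- The right side exceeds the left by `2 * D e * A e + (sw.alphaMax ^ 2 - D e ^ 2)`.
  have hnat : (Q e - D e + A e) ^ 2 + 2 * Q e * D e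
      ≤ Q e ^ 2 + 2 * Q e * A e + (sw.alphaMax ^ 2 + A e ^ 2) := by
    obtain ⟨m, hm⟩ := Nat.exists_eq_add_of_le h1
    have h3 : Q e - D e = m := by omega
    rw [h3, hm]
    nlinarith [Nat.mul_le_mul h2 h2, Nat.zero_le (D e * A e)]
  exact_mod_cast hnat

/-- No pair is ever scheduled more than `alphaMax` swaps, so a queue of that length never truncates
the schedule. -/
theorem serviceRate_swapLaw_staticPolicy {κ : (Fin K → ℕ) → PMF (PairVec K)}
    (hκ : ∀ a, ∀ π ∈ (κ a).support, IsFeasible a π) {Q : PairVec K} {e : UserPair K}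
    (hQ : sw.alphaMax ≤ Q e) :
    serviceRate sw (swapLaw (staticPolicy κ hκ) Q) e = serviceRate sw κ e := by
  simp only [serviceRate, swapLaw, mean_map]
  refine mean_congr fun a ha => mean_congr fun W hW => ?_
  have h1 := (hκ a W hW).le e
  have h2 := Finset.mem_range.1 (Fintype.mem_piFinset.1
    (mem_availabilities_of_linkLaw_ne_zero sw ha) e.1.1)
  rw [min_eq_left (by omega)]

/-- For a long queue the service surplus `ε` gives the drift `-2 * ε * Q e`. For a queue shorter
than `alphaMax` the missing service costs at most the constant `2 * alphaMax * (r + ε)`. -/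
theorem mean_slot_sq_add_le_of_lt {κ : (Fin K → ℕ) → PMF (PairVec K)}
    (hκ : ∀ a, ∀ π ∈ (κ a).support, IsFeasible a π) {r ε : ℝ≥0} {arr : UserPair K → PMF ℕ}
    {e : UserPair K} (harr : IsRequestLaw r (arr e)) (Q : PairVec K)
    (hε : r ≠ 0 → (r + ε : ℝ≥0∞) ≤ serviceRate sw κ e) (hQ : r = 0 → Q e = 0) :
    mean (slot sw (staticPolicy κ hκ) arr Q) (fun x => (x e : ℝ≥0∞) ^ 2) + 2 * ε * Q e
      ≤ (Q e : ℝ≥0∞) ^ 2 + ((sw.alphaMax : ℝ≥0∞) ^ 2 + (mean (arr e) fun k => (k : ℝ≥0∞) ^ 2)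
        + 2 * sw.alphaMax * (r + ε)) := by
  have hdrift := mean_slot_sq_add_le (sw := sw) (pol := staticPolicy κ hκ) harr Q
  set M := mean (slot sw (staticPolicy κ hκ) arr Q) (fun x => (x e : ℝ≥0∞) ^ 2)
  set B := (sw.alphaMax : ℝ≥0∞) ^ 2 + mean (arr e) fun k => (k : ℝ≥0∞) ^ 2
  by_cases hα : sw.alphaMax ≤ Q e
  · by_cases hr : r = 0
    · rw [hQ hr] at hdrift ⊢
      simp only [Nat.cast_zero, mul_zero, zero_mul, add_zero] at hdrift ⊢
      rw [← add_assoc]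
      exact hdrift.trans le_self_add
    · rw [serviceRate_swapLaw_staticPolicy hκ hα] at hdrift
      have hfin : (2 * Q e * r : ℝ≥0∞) ≠ ⊤ := by finiteness
      refine (ENNReal.add_le_add_iff_right hfin).1 ?_
      calc M + 2 * ε * Q e + 2 * Q e * r = M + 2 * Q e * (r + ε) := by ring
        _ ≤ M + 2 * Q e * serviceRate sw κ e := by gcongr; exact hε hr
        _ ≤ _ := hdrift
        _ ≤ (Q e : ℝ≥0∞) ^ 2 + 2 * Q e * r + B + 2 * sw.alphaMax * (r + ε) := le_self_add
        _ = _ := by ring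
  · have hle : (Q e : ℝ≥0∞) ≤ sw.alphaMax := by exact_mod_cast (not_le.1 hα).le
    calc M + 2 * ε * Q e ≤ ((Q e : ℝ≥0∞) ^ 2 + 2 * Q e * r + B) + 2 * ε * Q e := by
          gcongr
          exact le_self_add.trans hdrift
      _ = (Q e : ℝ≥0∞) ^ 2 + (B + 2 * Q e * (r + ε)) := by ring
      _ ≤ _ := by gcongr

theorem tendsto_asProbabilityMeasure {p : ℕ → PMF (PairVec K)} {μ : PMF (PairVec K)}
    (h : ∀ f : PairVec K → ℝ≥0∞, (∀ y, f y ≤ 1) →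
      Tendsto (fun n => mean (p n) f) atTop (𝓝 (mean μ f))) :
    Tendsto (fun n => asProbabilityMeasure (p n)) atTop (𝓝 (asProbabilityMeasure μ)) := by
  rw [MeasureTheory.ProbabilityMeasure.tendsto_iff_forall_lintegral_tendsto]
  intro g
  set c : ℝ≥0 := nndist g 0 + 1 with hc
  have hc0 : c ≠ 0 := by positivity
  have hg : ∀ y, g y / c ≤ 1 := fun y =>
    div_le_one_of_le₀ ((BoundedContinuousFunction.NNReal.upper_bound g y).trans le_self_add)
      zero_le
  have hmean : ∀ q : PMF (PairVec K),
      ∫⁻ ω, g ω ∂(asProbabilityMeasure q : MeasureTheory.Measure (PairVec K))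
        = c * mean q fun y => ((g y / c : ℝ≥0) : ℝ≥0∞) := by
    intro q
    rw [← mean_const_mul, mean_eq_lintegral]
    refine MeasureTheory.lintegral_congr fun y => ?_
    rw [← ENNReal.coe_mul, mul_div_cancel₀ _ hc0]
  simp only [hmean]
  exact ENNReal.Tendsto.const_mul (h _ fun y => by exact_mod_cast hg y)
    (Or.inr ENNReal.coe_ne_top)

/-- The quadratic Lyapunov function has linear negative drift, so the ergodic theorem yields both
convergence and a finite stationary mean of each queue. -/
theorem exists_isStable_of_mem_explicitRegion {rate : UserPair K → ℝ≥0}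
    {arr : UserPair K → PMF ℕ} (harr : ∀ e, IsRequestLaw (rate e) (arr e))
    (h : rate ∈ explicitRegion sw) : ∃ pol : Policy K, IsStable sw pol rate arr := by
  obtain ⟨κ, hκ, hκ0, hrate⟩ := exists_swap_laws h
  have hε : ∀ e, ∃ ε : ℝ≥0, 0 < ε ∧
      (rate e ≠ 0 → (rate e + ε : ℝ≥0∞) ≤ serviceRate sw κ e) := by
    intro e
    by_cases he : rate e = 0
    -- Any positive value works for an idle pair; positivity keeps the sublevel sets of the linear
    -- function finite.
    · exact ⟨1, one_pos, fun hne => absurd he hne⟩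
    · obtain ⟨ε, hε, hlt⟩ := ENNReal.lt_iff_exists_add_pos_lt.1 (hrate e he)
      exact ⟨ε, hε, fun _ => hlt.le⟩
  choose ε hε0 hε using hε
  set pol := staticPolicy κ hκ with hpol
  set s : Set (PairVec K) := {x | ∀ e, rate e = 0 → x e = 0} with hs
  have hm2 : ∀ e, ((mean (arr e) fun k => (k : ℝ≥0∞) ^ 2).toNNReal : ℝ≥0∞)
      = mean (arr e) fun k => (k : ℝ≥0∞) ^ 2 := fun e =>
    ENNReal.coe_toNNReal (harr e).second_moment
  have H : IsErgodic (slot sw pol arr) s (fun x => ∑ e, (x e : ℝ≥0) ^ 2)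
      (fun x => ∑ e, 2 * ε e * x e)
      (∑ e, ((sw.alphaMax : ℝ≥0) ^ 2 + (mean (arr e) fun k => (k : ℝ≥0∞) ^ 2).toNNReal
        + 2 * sw.alphaMax * (rate e + ε e))) := by
    refine ⟨fun x hx y hy e he => ?_, fun x hx => ?_, fun c => ?_, fun x hx y hy => ?_⟩
    · obtain ⟨D, A, -, hA, rfl⟩ := (slot_ne_zero sw pol x).1 hy
      have h0 : A e = 0 := IsRequestLaw.eq_zero (he ▸ harr e) (hA e)
      simp [h0, hx e he]
    · push_cast
      simp only [hm2]
      rw [mean_sum, ← Finset.sum_add_distrib, ← Finset.sum_add_distrib]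
      exact Finset.sum_le_sum fun e _ =>
        mean_slot_sq_add_le_of_lt hκ (harr e) x (hε e) (hx e)
    · refine (Set.Finite.pi' (t := fun e => Set.Iic ⌊c / (2 * ε e)⌋₊)
        fun e => Set.finite_Iic _).subset ?_
      rintro x ⟨-, hx⟩ e
      have h2 : 0 < 2 * ε e := mul_pos two_pos (hε0 e)
      refine Nat.le_floor ((le_div_iff₀ h2).2 ?_)
      rw [mul_comm]
      exact (Finset.single_le_sum (f := fun e => 2 * ε e * (x e : ℝ≥0))
        (fun _ _ => zero_le) (Finset.mem_univ e)).trans hx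
    · exact meet_of_idle (fun _ a => hκ0 a) harr hx hy
  obtain ⟨μ, hμ, hlim⟩ := H.exists_limit ⟨0, fun _ _ => rfl⟩
  refine ⟨pol, μ, fun x hx => tendsto_asProbabilityMeasure fun f hf => ?_, fun e => ?_⟩
  · simp only [queueLaw_eq_iterLaw]
    exact hlim x hx f hf
  · have h1 : (2 * ε e : ℝ≥0∞) * mean μ (fun x => (x e : ℝ≥0∞)) ≠ ⊤ := by
      rw [← mean_const_mul]
      refine ne_top_of_le_ne_top ?_ ((mean_mono fun x _ => ?_).trans hμ)
      · exact ENNReal.add_ne_top.2 ⟨ENNReal.coe_ne_top, ENNReal.one_ne_top⟩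
      · have := Finset.single_le_sum (f := fun e => 2 * ε e * (x e : ℝ≥0))
          (fun _ _ => zero_le) (Finset.mem_univ e)
        exact_mod_cast this
    have h2 : (2 * ε e : ℝ≥0∞) ≠ 0 := by
      simpa using (hε0 e).ne'
    intro htop
    exact h1 (by rw [mean, htop, ENNReal.mul_top h2])

end QuantumSwitch

end

theorem theorem3 {K : ℕ} (sw : QuantumSwitch.Params K)
    (arr : (QuantumSwitch.UserPair K → ℝ≥0) → QuantumSwitch.UserPair K → PMF ℕ)
    (harr : ∀ (rate : QuantumSwitch.UserPair K → ℝ≥0) (e : QuantumSwitch.UserPair K),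
      QuantumSwitch.IsRequestLaw (rate e) (arr rate e)) :
    QuantumSwitch.capacityRegion sw arr = QuantumSwitch.explicitRegion sw := by
  ext rate
  constructor
  · rintro ⟨pol, hst⟩
    exact QuantumSwitch.mem_explicitRegion_of_isStable (harr rate) hst
  · exact QuantumSwitch.exists_isStable_of_mem_explicitRegion (harr rate)
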